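/- Notation. All functions are $2\pi$-periodic on $\mathbb R$ (functions on the circle $\mathbb T$); arcs $J$ of $\mathbb T$ are identified with intervals of $\mathbb R$ of length at most $2\pi$, and $|J|$ is the length of $J$. A weight is a $2\pi$-periodic measurable function $\gamma:\mathbb R\to[0,\infty]$ that is positive a.e.; $\gamma(J)=\int_J\gamma$. The weight $\gamma$ belongs to the class $A\mathfrak S_p^1$ if - for $1<p<\infty$: $\gamma$ is integrable over a period, doubling ($\gamma(2I)\le D\,\gamma(I)$ for all arcs $I$, with $2I$ the interval with the same midpoint and twice the length), and $$[\gamma]_p:=\sup_J\frac{\gamma(J)}{|J|}\Big(\frac1{|J|}\int_J\gamma^{-1/(p-1)}\Big)^{p-1}<\infty ;$$ - for $p=1$: $[\gamma]_1:=\sup_J\gamma(J)/|J|<\infty$ and $\gamma\ge c$ a.e. for some constant $c>0$; - for $p=\infty$: $\gamma= 1$ a.e. Let $\|f\|_{p,\gamma}=\big(\int_{-\pi}^{\pi}|f|^p\gamma\,dx\big)^{1/p}$ for $p<\infty$ and $\|f\|_{\infty,\gamma}=\operatorname{ess\,sup}|f|$, and let $L_{p,\gamma}$ be the space of real measurable $2\pi$-periodic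 functions of finite norm. For $r\ge1$ let $W^r_{p,\gamma}$ be the class of $f\in L_{p,\gamma}$ such that $f^{(r-1)}$ exists and is absolutely continuous (as a periodic function on $\mathbb R$, on every bounded interval) and $f^{(r)}\in L_{p,\gamma}$. For $v>0$ let $\mathfrak T_vf(x)=\frac1v\int_x^{x+v}f(t)\,dt$ and $\Omega_l(f,v)_{p,\gamma}=\|(I-\mathfrak T_v)^lf\|_{p,\gamma}$. Let $\mathcal T_m$ be the set of real trigonometric polynomials of degree at most $m$, $S_m(f)$ the $m$-th partial sum of the Fourier series of $f$, and $V_n(f)=\frac1n\sum_{i=0}^{n-1}S_{n+i}(f)$ the de la Vallée-Poussin mean. **Theorem S3 (simultaneous approximation).** Let $1\le p\le\infty$, let $r,l\ge1$ be integers, and let $A\ge 0$ and $c>0$. There is a constant $C>0$, depending only on $p,l,r,A$ and, for $p=1$, on $c$, such that for every $\gamma\in A\mathfrak S_p^1$ with $[\gamma]_p\le A$ (put $[\gamma]_\infty:=1$) and, if $p=1$, $\gamma\ge c$ a.e., for every integer $n\ge1$ and every $f\in W^r_{p,\gamma}$ there is $\Phi\in\mathcal T_{2n-1}$, namely $\Phi=V_n(f)$,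 such that $$\|f^{(k)}-\Phi^{(k)}\|_{p,\gamma}\le \frac{C}{n^{r-k}}\,\Omega_l\Big(f^{(r)},\frac1n\Big)_{p,\gamma}\qquad\text{for all }k=0,1,\dots,r .$$ -/

import Mathlib

open MeasureTheory Set
open scoped ENNReal NNReal

namespace TrigApprox

noncomputable section

/-! ### Weights. The circle is `[-π, π]` with end points identified; functions on it are
`2π`-periodic functions on `ℝ`, and its arcs are the intervals `(a, b]` with `b - a ≤ 2π`. -/

/-- `γ(I)` for the interval `I = (a, b]`. -/
def mass (γ : ℝ → ℝ≥0∞) (a b : ℝ) : ℝ≥0∞ := ∫⁻ x in Ioc a b, γ x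

/-- The mean value of `γ` over the interval `(a, b]`. -/
def mean (γ : ℝ → ℝ≥0∞) (a b : ℝ) : ℝ≥0∞ := mass γ a b / ENNReal.ofReal (b - a)

/-- A `2π`-periodic weight: measurable, with values in `[0, ∞]`, positive almost everywhere. -/
structure IsWeight (γ : ℝ → ℝ≥0∞) : Prop where
  measurable : Measurable γ
  periodic : Function.Periodic γ (2 * Real.pi)
  pos : ∀ᵐ x, 0 < γ x

/-- Integrability over a period and the doubling property `γ(2I) ≤ D γ(I)`, where `I` is the
interval with centre `c` and length `2ρ`. -/
def IsDoubling (γ : ℝ → ℝ≥0∞) : Prop :=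
  mass γ (-Real.pi) Real.pi < ∞ ∧
    ∃ D : ℝ≥0, ∀ c ρ : ℝ, 0 < ρ → ρ ≤ Real.pi →
      mass γ (c - 2 * ρ) (c + 2 * ρ) ≤ D * mass γ (c - ρ) (c + ρ)

/-- `[γ]_1`, the supremum of the mean values of `γ` over arcs. -/
def meanSup (γ : ℝ → ℝ≥0∞) : ℝ≥0∞ :=
  ⨆ (a : ℝ) (b : ℝ) (_ : a < b) (_ : b ≤ a + 2 * Real.pi), mean γ a b

/-- `[γ]_p` for `1 < p < ∞`, the Muckenhoupt constant. -/
def muckenhouptSup (p : ℝ) (γ : ℝ → ℝ≥0∞) : ℝ≥0∞ :=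
  ⨆ (a : ℝ) (b : ℝ) (_ : a < b) (_ : b ≤ a + 2 * Real.pi),
    mean γ a b * mean (fun x => γ x ^ (-1 / (p - 1))) a b ^ (p - 1)

/-- The constant `[γ]_p` of a weight, for `1 ≤ p ≤ ∞`; only the weight `1` is admitted for
`p = ∞`, and the value there is `1`. -/
def weightConst (p : ℝ≥0∞) (γ : ℝ → ℝ≥0∞) : ℝ≥0∞ :=
  if p = 1 then meanSup γ else if p = ∞ then 1 else muckenhouptSup p.toReal γ

/-- The class `𝔖₁`: bounded means over arcs, and a positive essential lower bound. -/
def IsS1 (γ : ℝ → ℝ≥0∞) : Prop :=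
  meanSup γ < ∞ ∧ ∃ c : ℝ≥0, 0 < c ∧ ∀ᵐ x, (c : ℝ≥0∞) ≤ γ x

/-- The Muckenhoupt class `A_p` of the circle, `1 < p < ∞`. -/
def IsAp (p : ℝ) (γ : ℝ → ℝ≥0∞) : Prop :=
  IsDoubling γ ∧ muckenhouptSup p γ < ∞

/-- The class `A𝔖_p^1`: it is `A_p` for `1 < p < ∞`, `𝔖₁` for `p = 1`, and `γ = 1` for `p = ∞`. -/
structure IsASWeight (p : ℝ≥0∞) (γ : ℝ → ℝ≥0∞) : Prop where
  weight : IsWeight γ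
  one : p = 1 → IsS1 γ
  mid : 1 < p → p < ∞ → IsAp p.toReal γ
  top : p = ∞ → ∀ᵐ x, γ x = 1

/-! ### Spaces, norms and the modulus of smoothness -/

/-- The measure `γ(x) dx` on one period. -/
def weightedMeasure (γ : ℝ → ℝ≥0∞) : Measure ℝ :=
  (volume.restrict (Ioc (-Real.pi) Real.pi)).withDensity γ

/-- The norm of `L_{p,γ}`. For `p = ∞` it is the essential supremum, and since a weight is positive
almost everywhere, `γ(x) dx` and `dx` have the same null sets. -/
def wnorm (p : ℝ≥0∞) (γ : ℝ → ℝ≥0∞) (f : ℝ → ℝ) : ℝ≥0∞ := eLpNorm f p (weightedMeasure γ)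

/-- The space `L_{p,γ}` of `2π`-periodic functions. -/
def MemL (p : ℝ≥0∞) (γ : ℝ → ℝ≥0∞) (f : ℝ → ℝ) : Prop :=
  Function.Periodic f (2 * Real.pi) ∧ MemLp f p (weightedMeasure γ)

/-- The Sobolev class `W^r_{p,γ}`, `r ≥ 1`: `f ∈ L_{p,γ}`, the derivative of order `r - 1` exists and
is absolutely continuous, and the derivative of order `r`, which then exists almost everywhere,
is in `L_{p,γ}`. -/
structure MemW (r : ℕ) (p : ℝ≥0∞) (γ : ℝ → ℝ≥0∞) (f : ℝ → ℝ) : Prop where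
  mem : MemL p γ f
  contDiff : ContDiff ℝ ((r - 1 : ℕ) : WithTop ℕ∞) f
  absCont : ∀ a b : ℝ, AbsolutelyContinuousOnInterval (iteratedDeriv (r - 1) f) a b
  memDeriv : MemL p γ (iteratedDeriv r f)

/-- The one-sided Steklov mean; for `v = 0` it is the identity. -/
def steklov (v : ℝ) (f : ℝ → ℝ) : ℝ → ℝ :=
  if v = 0 then f else fun x => (1 / v) * ∫ t in x..(x + v), f t

/-- The modulus of smoothness of order `l`: the norm of `(I - T_v)^l f`, where `T_v` is the
one-sided Steklov mean. -/
def modulus (l : ℕ) (p : ℝ≥0∞) (γ : ℝ → ℝ≥0∞) (f : ℝ → ℝ) (v : ℝ) : ℝ≥0∞ :=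
  wnorm p γ ((fun g : ℝ → ℝ => g - steklov v g)^[l] f)

/-! ### Trigonometric polynomials and the de la Vallée-Poussin mean -/

/-- The trigonometric sum with coefficients `a`, `b` and degree at most `n`. -/
def trigSum (a b : ℕ → ℝ) (n : ℕ) (x : ℝ) : ℝ :=
  a 0 / 2 + ∑ k ∈ Finset.Icc 1 n, (a k * Real.cos (k * x) + b k * Real.sin (k * x))

/-- Real trigonometric polynomials of degree at most `n`. -/
def trigPoly (n : ℕ) : Set (ℝ → ℝ) := {U | ∃ a b : ℕ → ℝ, U = trigSum a b n}

/-- The Fourier cosine coefficient `a_k(f)`. -/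
def fourierCos (f : ℝ → ℝ) (k : ℕ) : ℝ :=
  (1 / Real.pi) * ∫ t in (-Real.pi)..Real.pi, f t * Real.cos (k * t)

/-- The Fourier sine coefficient `b_k(f)`. -/
def fourierSin (f : ℝ → ℝ) (k : ℕ) : ℝ :=
  (1 / Real.pi) * ∫ t in (-Real.pi)..Real.pi, f t * Real.sin (k * t)

/-- The partial sum `S_n(f)` of the Fourier series. -/
def partialSum (n : ℕ) (f : ℝ → ℝ) : ℝ → ℝ := trigSum (fourierCos f) (fourierSin f) n

/-- The de la Vallée-Poussin mean `V_n(f) = (S_n(f) + ⋯ + S_{2n-1}(f)) / n`. -/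
def valleePoussin (n : ℕ) (f : ℝ → ℝ) : ℝ → ℝ :=
  fun x => (1 / (n : ℝ)) * ∑ i ∈ Finset.range n, partialSum (n + i) f x

end

end TrigApprox

namespace TrigApprox

/-! ### Averages on weighted spaces -/

/-! The weight enters only through one fact, `AvgBound`: averaging over arcs of length at most `π`
that contain or touch the point `x` is bounded on `L_{p,γ}`, with a constant controlled by `A` (and
by `c` if `p = 1`). This needs no maximal function: for finite `p` it follows from Tonelli, with
Hölder's inequality when `p > 1` (`avgBound_of_Ap`, `avgBound_one`), and it is immediate for `p =
∞`.

A Fourier multiplier whose symbol at scale `n` has sum `O(n)` and second differences of sum `O(1/n)`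
has a kernel of size `O(min(n, 1/(n y²)))`. Such a kernel is dominated by dyadic averages with
geometrically decreasing coefficients, so the operator is bounded uniformly in `n`
(`eLpNorm_mult_le`). Samples `φ(j/n)` of a smooth `φ` that is `O(s⁻²)` with two derivatives are of
this kind, and so is the trapezoidal symbol of `V_n`.

Put `T = T_{1/n}` and let `H = highPass n` remove the low frequencies by a smooth cut-off `η(j/n)`.
Away from `0` the symbol of `T` is `τ(j/n)`, where `τ(s) = (e^{is} - 1)/(is)` has modulus less than
`1` and decays. Hence `1 - τ` can be inverted on the range of `H`, and `‖H f‖ ≤ C ‖(I - T) f‖`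
(`eLpNorm_highPass_le`). Since `H` and `T` commute, `‖H^l f‖ ≤ C^l ‖(I - T)^l f‖`. If `F' = G`, then
`(I - T) F` is pointwise at most `1/n` times an average of `|G|`, so each factor `H` also buys one
derivative: `‖H F‖ ≤ (C/n) ‖G‖`, and likewise with powers of `H` applied to `F` and `G`.

Finally `V_n` fixes everything that `H` removes, so `(I - V_n) f = (I - V_n) H^m f` for every `m`
(`sub_mult_vpSymbol_eq`). Take `m = (r - k) + l` for `f^{(k)}`: the first `r - k` factors give
`n^{-(r-k)}` and lead to `f^{(r)}`, the other `l` give the modulus. As `V_n` commutes with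
differentiation, this is the estimate for `f^{(k)} - Φ^{(k)}`. -/

theorem lintegral_period_eq {f : ℝ → ℝ≥0∞} (hf : Function.Periodic f (2 * Real.pi)) (a b : ℝ) :
    ∫⁻ x in Ioc a (a + 2 * Real.pi), f x = ∫⁻ x in Ioc b (b + 2 * Real.pi), f x := by
  refine (isAddFundamentalDomain_Ioc Real.two_pi_pos a).setLIntegral_eq
    (isAddFundamentalDomain_Ioc Real.two_pi_pos b) f ?_
  rintro ⟨g, hg⟩ x
  obtain ⟨k, rfl⟩ := AddSubgroup.mem_zmultiples_iff.1 hg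
  change f (k • (2 * Real.pi) + x) = f x
  rw [add_comm]
  exact hf.zsmul k x

theorem setLIntegral_Ioc_comp_add (f : ℝ → ℝ≥0∞) (x a b : ℝ) :
    ∫⁻ u in Ioc a b, f (x + u) = ∫⁻ t in Ioc (x + a) (x + b), f t := by
  rw [← lintegral_indicator measurableSet_Ioc, ← lintegral_indicator measurableSet_Ioc,
    ← lintegral_add_left_eq_self ((Ioc (x + a) (x + b)).indicator f) x]
  congr 1
  ext u
  simp [indicator]

theorem setLIntegral_Ioc_comp_sub (f : ℝ → ℝ≥0∞) (x a b : ℝ) :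
    ∫⁻ u in Ioc a b, f (x - u) = ∫⁻ t in Ico (x - b) (x - a), f t := by
  rw [← lintegral_indicator measurableSet_Ioc, ← lintegral_indicator measurableSet_Ico,
    ← lintegral_sub_left_eq_self ((Ico (x - b) (x - a)).indicator f) x]
  congr 1
  ext u
  simp only [indicator, mem_Ioc, mem_Ico]
  have : (a < u ∧ u ≤ b) ↔ (x - b ≤ x - u ∧ x - u < x - a) := by
    constructor <;> rintro ⟨h1, h2⟩ <;> constructor <;> linarith
  simp only [this]

theorem lintegral_period_comp_sub {f : ℝ → ℝ≥0∞} (hf : Function.Periodic f (2 * Real.pi))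
    (u : ℝ) :
    ∫⁻ x in Ioc (-Real.pi) Real.pi, f (x - u) = ∫⁻ x in Ioc (-Real.pi) Real.pi, f x := by
  have h := setLIntegral_Ioc_comp_add f (-u) (-Real.pi) Real.pi
  have e := lintegral_period_eq hf (-u + -Real.pi) (-Real.pi)
  rw [show -u + -Real.pi + 2 * Real.pi = -u + Real.pi by ring,
    show -Real.pi + 2 * Real.pi = Real.pi by ring] at e
  rw [← e, ← h]
  simp_rw [sub_eq_neg_add]

theorem lintegral_weightedMeasure {γ : ℝ → ℝ≥0∞} (hγ : Measurable γ) (f : ℝ → ℝ≥0∞)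
    (hf : Measurable f) :
    ∫⁻ x, f x ∂(weightedMeasure γ) = ∫⁻ x in Ioc (-Real.pi) Real.pi, γ x * f x := by
  rw [weightedMeasure, lintegral_withDensity_eq_lintegral_mul _ hγ hf]
  rfl

/-- The average of `f` over the translate by `x` of the interval `(a, b]`. -/
noncomputable def avg (a b : ℝ) (f : ℝ → ℝ≥0∞) (x : ℝ) : ℝ≥0∞ :=
  (ENNReal.ofReal (b - a))⁻¹ * ∫⁻ u in Ioc a b, f (x + u)

/-- Averages over the arcs of length at most `π` that start, end or pass at the given point are
bounded operators on `L_{p,γ}`, with norm at most `K`. -/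
def AvgBound (p : ℝ≥0∞) (γ : ℝ → ℝ≥0∞) (K : ℝ≥0∞) : Prop :=
  ∀ f : ℝ → ℝ≥0∞, Measurable f → Function.Periodic f (2 * Real.pi) →
    ∀ a b : ℝ, a ≤ 0 → 0 ≤ b → a < b → b - a ≤ Real.pi →
      eLpNorm (avg a b f) p (weightedMeasure γ) ≤ K * eLpNorm f p (weightedMeasure γ)

theorem measurable_window {f : ℝ → ℝ≥0∞} (hf : Measurable f) (a b : ℝ) :
    Measurable fun x => ∫⁻ u in Ioc a b, f (x + u) := by
  refine Measurable.lintegral_prod_right' (f := fun z : ℝ × ℝ => f (z.1 + z.2)) ?_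
  fun_prop

theorem measurable_avg {f : ℝ → ℝ≥0∞} (hf : Measurable f) (a b : ℝ) :
    Measurable (avg a b f) := (measurable_window hf a b).const_mul _

theorem periodic_window {f : ℝ → ℝ≥0∞} (hf : Function.Periodic f (2 * Real.pi)) (a b : ℝ) :
    Function.Periodic (fun x => ∫⁻ u in Ioc a b, f (x + u)) (2 * Real.pi) := by
  intro x
  simp only
  congr 1
  ext u
  rw [show x + 2 * Real.pi + u = x + u + 2 * Real.pi by ring, hf]

/-- Tonelli and translation invariance on the circle: the adjoint of integration over the windows `x
+ (a, b]` is integration over the reflected windows `x - (a, b]`. -/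
theorem lintegral_period_window {g h : ℝ → ℝ≥0∞} (hg : Measurable g) (hh : Measurable h)
    (pg : Function.Periodic g (2 * Real.pi)) (ph : Function.Periodic h (2 * Real.pi)) (a b : ℝ) :
    ∫⁻ x in Ioc (-Real.pi) Real.pi, g x * ∫⁻ u in Ioc a b, h (x + u) =
      ∫⁻ x in Ioc (-Real.pi) Real.pi, h x * ∫⁻ u in Ioc a b, g (x - u) := by
  have m1 : Measurable fun z : ℝ × ℝ => g z.1 * h (z.1 + z.2) := by fun_prop
  have m2 : Measurable fun z : ℝ × ℝ => h z.1 * g (z.1 - z.2) := by fun_prop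
  calc _ = ∫⁻ x in Ioc (-Real.pi) Real.pi, ∫⁻ u in Ioc a b, g x * h (x + u) := by
        congr 1; ext x
        rw [lintegral_const_mul]
        fun_prop
    _ = ∫⁻ u in Ioc a b, ∫⁻ x in Ioc (-Real.pi) Real.pi, g x * h (x + u) :=
        lintegral_lintegral_swap m1.aemeasurable
    _ = ∫⁻ u in Ioc a b, ∫⁻ x in Ioc (-Real.pi) Real.pi, h x * g (x - u) := by
        congr 1; ext u
        rw [← lintegral_period_comp_sub (f := fun x => g x * h (x + u)) _ u]
        · simp [mul_comm]
        · intro x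
          simp only
          rw [pg, show x + 2 * Real.pi + u = x + u + 2 * Real.pi by ring, ph]
    _ = ∫⁻ x in Ioc (-Real.pi) Real.pi, ∫⁻ u in Ioc a b, h x * g (x - u) :=
        (lintegral_lintegral_swap m2.aemeasurable).symm
    _ = _ := by
        congr 1; ext x
        rw [lintegral_const_mul]
        fun_prop

theorem setLIntegral_le_mass {g : ℝ → ℝ≥0∞} {s : Set ℝ} {c d : ℝ} (h : s ⊆ Icc c d) :
    ∫⁻ t in s, g t ≤ mass g c d := by
  rw [mass, setLIntegral_congr Ioc_ae_eq_Icc]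
  exact lintegral_mono_set h

theorem window_sub_le_mass {g : ℝ → ℝ≥0∞} {a b : ℝ} (ha : a ≤ 0) (hb : 0 ≤ b) (x : ℝ) :
    ∫⁻ u in Ioc a b, g (x - u) ≤ mass g (x - (b - a)) (x + (b - a)) := by
  rw [setLIntegral_Ioc_comp_sub]
  exact setLIntegral_le_mass fun t ht => ⟨by linarith [ht.1], by linarith [ht.2]⟩

theorem eLpNorm_mul_const_ennreal {α : Type*} [MeasurableSpace α] {μ : Measure α} {p : ℝ≥0∞}
    {f : α → ℝ≥0∞} {c : ℝ≥0∞} (hp : 1 ≤ p) (hp' : p ≠ ∞) (hf : Measurable f) :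
    eLpNorm (fun x => c * f x) p μ = c * eLpNorm f p μ := by
  have h0 : p ≠ 0 := (zero_lt_one.trans_le hp).ne'
  have hpos : 0 < p.toReal := ENNReal.toReal_pos h0 hp'
  rw [eLpNorm_eq_lintegral_rpow_enorm_toReal h0 hp', eLpNorm_eq_lintegral_rpow_enorm_toReal h0 hp']
  simp only [enorm_eq_self, ENNReal.mul_rpow_of_nonneg _ _ hpos.le]
  rw [lintegral_const_mul _ (hf.pow_const _), ENNReal.mul_rpow_of_nonneg _ _ (by positivity),
    ← ENNReal.rpow_mul, mul_one_div_cancel hpos.ne', ENNReal.rpow_one]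

/-- Hölder for `f = (f γ^{1/P}) · γ^{-1/P}`; this factorization in `[0, ∞]` requires `0 < γ < ∞`
almost everywhere. -/
theorem holder_window {P : ℝ} (hP : 1 < P) {γ f : ℝ → ℝ≥0∞} (hγ : Measurable γ)
    (hf : Measurable f) (h0 : ∀ᵐ x, 0 < γ x) (h1 : ∀ᵐ x, γ x < ∞) (s : Set ℝ) :
    (∫⁻ t in s, f t) ^ P ≤
      (∫⁻ t in s, γ t * f t ^ P) * (∫⁻ t in s, γ t ^ (-1 / (P - 1))) ^ (P - 1) := by
  have hP0 : 0 < P := by linarith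
  have hpq : P.HolderConjugate (P / (P - 1)) := Real.HolderConjugate.conjExponent hP
  set Q := P / (P - 1) with hQ
  have hP1 : P - 1 ≠ 0 := by linarith
  have key : ∫⁻ t in s, f t ≤ (∫⁻ t in s, γ t * f t ^ P) ^ (1 / P) *
      (∫⁻ t in s, γ t ^ (-1 / (P - 1))) ^ (1 / Q) := by
    have := ENNReal.lintegral_mul_le_Lp_mul_Lq (volume.restrict s) hpq
      (f := fun t => f t * γ t ^ (1 / P)) (g := fun t => γ t ^ (-(1 / P)))
      (by fun_prop) (by fun_prop)
    refine le_trans (le_of_eq ?_) (this.trans (le_of_eq ?_))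
    · refine lintegral_congr_ae ?_
      filter_upwards [ae_restrict_of_ae h0, ae_restrict_of_ae h1] with t ht ht'
      simp only [Pi.mul_apply]
      rw [mul_assoc, ← ENNReal.rpow_add _ _ ht.ne' ht'.ne]
      simp
    · congr 2
      · congr 1; ext t
        rw [ENNReal.mul_rpow_of_nonneg _ _ hP0.le, ← ENNReal.rpow_mul,
          one_div_mul_cancel hP0.ne', ENNReal.rpow_one, mul_comm]
      · congr 1; ext t
        rw [← ENNReal.rpow_mul]
        congr 1
        rw [hQ]; field_simp
  calc _ ≤ ((∫⁻ t in s, γ t * f t ^ P) ^ (1 / P) *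
      (∫⁻ t in s, γ t ^ (-1 / (P - 1))) ^ (1 / Q)) ^ P := by gcongr
    _ = _ := by
      rw [ENNReal.mul_rpow_of_nonneg _ _ hP0.le, ← ENNReal.rpow_mul, ← ENNReal.rpow_mul,
        one_div_mul_cancel hP0.ne', ENNReal.rpow_one]
      congr 2
      rw [hQ]; field_simp

theorem ae_lt_top_of_mass {γ : ℝ → ℝ≥0∞} (hγ : Measurable γ)
    (h : ∀ a b : ℝ, mass γ a b < ∞) : ∀ᵐ x, γ x < ∞ := by
  have : ∀ n : ℕ, ∀ᵐ x ∂(volume.restrict (Ioc (-(n : ℝ)) n)), γ x < ∞ := fun n =>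
    ae_lt_top hγ (h _ _).ne
  rw [← Measure.restrict_univ (μ := (volume : Measure ℝ)),
    show (univ : Set ℝ) = ⋃ n : ℕ, Ioc (-(n : ℝ)) n from ?_, ae_restrict_iUnion_iff]
  · exact this
  · symm
    rw [eq_univ_iff_forall]
    intro x
    obtain ⟨n, hn⟩ := exists_nat_gt |x|
    rw [abs_lt] at hn
    exact mem_iUnion.2 ⟨n, hn.1, hn.2.le⟩

theorem ae_lt_top_of_period {γ : ℝ → ℝ≥0∞} (hγ : Measurable γ)
    (hp : Function.Periodic γ (2 * Real.pi)) (h : mass γ (-Real.pi) Real.pi < ∞) :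
    ∀ᵐ x, γ x < ∞ := by
  have hN : ∀ n : ℕ, mass γ (-Real.pi) (-Real.pi + n * (2 * Real.pi)) < ∞ := by
    intro n
    induction n with
    | zero => simp [mass]
    | succ n ih =>
      have e := lintegral_period_eq hp (-Real.pi + n * (2 * Real.pi)) (-Real.pi)
      rw [show -Real.pi + 2 * Real.pi = Real.pi by ring] at e
      have : mass γ (-Real.pi) (-Real.pi + (n + 1 : ℕ) * (2 * Real.pi)) ≤
          mass γ (-Real.pi) (-Real.pi + n * (2 * Real.pi)) + mass γ (-Real.pi) Real.pi := by
        unfold mass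
        rw [← e]
        refine le_trans (lintegral_mono_set ?_) (lintegral_union_le _ _ _)
        intro x hx
        push_cast at hx
        rcases le_or_gt x (-Real.pi + n * (2 * Real.pi)) with h | h
        · exact Or.inl ⟨hx.1, h⟩
        · exact Or.inr ⟨h, by linarith [hx.2]⟩
      exact this.trans_lt (ENNReal.add_lt_top.2 ⟨ih, h⟩)
  refine ae_lt_top_of_mass hγ fun a b => ?_
  obtain ⟨n, hn⟩ := exists_nat_gt ((b - a) / (2 * Real.pi))
  have e : mass γ a (a + n * (2 * Real.pi)) = mass γ (-Real.pi) (-Real.pi + n * (2 * Real.pi)) := by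
    rcases Nat.eq_zero_or_pos n with rfl | hn'
    · simp [mass]
    · unfold mass
      have hpos : 0 < n * (2 * Real.pi) := by positivity
      have hq : Function.Periodic γ (n * (2 * Real.pi)) := hp.nat_mul n
      refine (isAddFundamentalDomain_Ioc hpos a).setLIntegral_eq
        (isAddFundamentalDomain_Ioc hpos (-Real.pi)) γ ?_
      rintro ⟨g, hg⟩ x
      obtain ⟨k, rfl⟩ := AddSubgroup.mem_zmultiples_iff.1 hg
      change γ (k • (n * (2 * Real.pi)) + x) = γ x
      rw [add_comm]
      exact hq.zsmul k x
  refine lt_of_le_of_lt ?_ (e.trans_lt (hN n))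
  refine lintegral_mono_set (Ioc_subset_Ioc_right ?_)
  rw [div_lt_iff₀ Real.two_pi_pos] at hn
  linarith

theorem mass_eq_mean_mul (γ : ℝ → ℝ≥0∞) {a b : ℝ} (h : a < b) :
    mass γ a b = mean γ a b * ENNReal.ofReal (b - a) := by
  rw [mean, ENNReal.div_mul_cancel]
  · simpa using h
  · exact ENNReal.ofReal_ne_top

/-- Hölder on each window, then passing to the adjoint, leaves `γ f^P` multiplied by a quantity that
the `A_p` condition bounds on the doubled arc `(x - ρ, x + ρ]`. The factor `2` is the ratio of the
lengths `2ρ` and `ρ`. -/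
theorem avgBound_of_Ap {p : ℝ≥0∞} (hp : 1 < p) (hp' : p < ∞) {γ : ℝ → ℝ≥0∞} {A : ℝ≥0∞}
    (hw : IsWeight γ) (hm : mass γ (-Real.pi) Real.pi < ∞)
    (hA : muckenhouptSup p.toReal γ ≤ A) : AvgBound p γ (2 * A ^ (1 / p.toReal)) := by
  intro f hf pf a b ha hb hab hba
  have hγ := hw.measurable
  set P := p.toReal with hPdef
  have hP : 1 < P := by
    rw [hPdef, ← ENNReal.toReal_one, ENNReal.toReal_lt_toReal (by simp) hp'.ne]; exact hp
  have hP0 : 0 < P := by linarith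
  have hp0 : p ≠ 0 := (zero_lt_one.trans hp).ne'
  set ρ := b - a with hρ
  have hρ0 : 0 < ρ := by simpa [hρ] using hab
  set σ : ℝ → ℝ≥0∞ := fun x => γ x ^ (-1 / (P - 1)) with hσ
  have mσ : Measurable σ := hγ.pow_const _
  have pσ : Function.Periodic σ (2 * Real.pi) := fun x => by simp only [hσ, hw.periodic x]
  set S : ℝ → ℝ≥0∞ := fun x => ∫⁻ u in Ioc a b, σ (x + u) with hS
  have mS : Measurable S := measurable_window mσ a b
  have pS : Function.Periodic S (2 * Real.pi) := periodic_window pσ a b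
  have hfin := ae_lt_top_of_period hγ hw.periodic hm
  have hmuck : ∀ x : ℝ, mass γ (x - ρ) (x + ρ) * mass σ (x - ρ) (x + ρ) ^ (P - 1) ≤
      A * ENNReal.ofReal (2 * ρ) ^ P := by
    intro x
    have hlt : x - ρ < x + ρ := by linarith
    have h1 : mean γ (x - ρ) (x + ρ) * mean σ (x - ρ) (x + ρ) ^ (P - 1) ≤ A := by
      refine le_trans ?_ hA
      refine le_iSup_of_le (x - ρ) (le_iSup_of_le (x + ρ) (le_iSup_of_le hlt
        (le_iSup_of_le ?_ le_rfl)))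
      linarith
    rw [mass_eq_mean_mul γ hlt, mass_eq_mean_mul σ hlt, show x + ρ - (x - ρ) = 2 * ρ by ring,
      ENNReal.mul_rpow_of_nonneg _ _ (by linarith : 0 ≤ P - 1)]
    have h2 : ENNReal.ofReal (2 * ρ) ^ P =
        ENNReal.ofReal (2 * ρ) * ENNReal.ofReal (2 * ρ) ^ (P - 1) := by
      nth_rewrite 2 [← ENNReal.rpow_one (ENNReal.ofReal (2 * ρ))]
      rw [← ENNReal.rpow_add _ _ (by simpa using hρ0) ENNReal.ofReal_ne_top]
      congr 1; ring
    rw [h2]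
    calc _ = (mean γ (x - ρ) (x + ρ) * mean σ (x - ρ) (x + ρ) ^ (P - 1)) *
        (ENNReal.ofReal (2 * ρ) * ENNReal.ofReal (2 * ρ) ^ (P - 1)) := by ring
      _ ≤ _ := by gcongr
  have main : ∫⁻ x in Ioc (-Real.pi) Real.pi, γ x * (∫⁻ u in Ioc a b, f (x + u)) ^ P ≤
      A * ENNReal.ofReal (2 * ρ) ^ P * ∫⁻ x in Ioc (-Real.pi) Real.pi, γ x * f x ^ P := by
    calc _ ≤ ∫⁻ x in Ioc (-Real.pi) Real.pi, (γ x * S x ^ (P - 1)) *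
          ∫⁻ u in Ioc a b, γ (x + u) * f (x + u) ^ P := by
          refine lintegral_mono fun x => ?_
          simp only
          rw [mul_assoc]
          refine mul_le_mul_right ?_ _
          rw [mul_comm, hS]
          simp only
          rw [setLIntegral_Ioc_comp_add f, setLIntegral_Ioc_comp_add σ,
            setLIntegral_Ioc_comp_add (fun t => γ t * f t ^ P)]
          exact holder_window hP hγ hf hw.pos hfin _
      _ = ∫⁻ x in Ioc (-Real.pi) Real.pi, (γ x * f x ^ P) *
          ∫⁻ u in Ioc a b, γ (x - u) * S (x - u) ^ (P - 1) := by
          refine lintegral_period_window (g := fun x => γ x * S x ^ (P - 1))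
            (h := fun x => γ x * f x ^ P) (by fun_prop) (by fun_prop) ?_ ?_ a b
          · intro x; simp only [hw.periodic x, pS x]
          · intro x; simp only [hw.periodic x, pf x]
      _ ≤ ∫⁻ x in Ioc (-Real.pi) Real.pi, (γ x * f x ^ P) * (A * ENNReal.ofReal (2 * ρ) ^ P) := by
          gcongr with x
          refine le_trans ?_ (hmuck x)
          -- For `u ∈ (a, b]` the window of the point `x - u` lies in `[x - ρ, x + ρ]`, whose length
          -- `2ρ ≤ 2π` is still that of an arc; this is why windows are limited to length `π`.
          calc _ ≤ ∫⁻ u in Ioc a b, γ (x - u) * mass σ (x - ρ) (x + ρ) ^ (P - 1) := by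
                refine setLIntegral_mono' measurableSet_Ioc fun u hu => ?_
                refine mul_le_mul_right (ENNReal.rpow_le_rpow ?_ (by linarith)) _
                rw [hS]
                simp only
                rw [setLIntegral_Ioc_comp_add]
                exact setLIntegral_le_mass fun t ht =>
                  ⟨by linarith [ht.1, hu.2], by linarith [ht.2, hu.1]⟩
            _ ≤ _ := by
                rw [lintegral_mul_const _ (by fun_prop)]
                gcongr
                exact window_sub_le_mass ha hb x
      _ = _ := by
          rw [lintegral_mul_const _ (by fun_prop), mul_comm]
  have e1 : eLpNorm (avg a b f) p (weightedMeasure γ) = (ENNReal.ofReal ρ)⁻¹ *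
      eLpNorm (fun x => ∫⁻ u in Ioc a b, f (x + u)) p (weightedMeasure γ) :=
    eLpNorm_mul_const_ennreal hp.le hp'.ne (measurable_window hf a b)
  rw [e1, eLpNorm_eq_lintegral_rpow_enorm_toReal hp0 hp'.ne,
    eLpNorm_eq_lintegral_rpow_enorm_toReal hp0 hp'.ne]
  simp only [enorm_eq_self]
  rw [lintegral_weightedMeasure hγ _ ((measurable_window hf a b).pow_const _),
    lintegral_weightedMeasure hγ _ (hf.pow_const _)]
  calc _ ≤ (ENNReal.ofReal ρ)⁻¹ * (A * ENNReal.ofReal (2 * ρ) ^ P *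
        ∫⁻ x in Ioc (-Real.pi) Real.pi, γ x * f x ^ P) ^ (1 / P) := by gcongr
    _ = ((ENNReal.ofReal ρ)⁻¹ * ENNReal.ofReal ρ) * (2 * A ^ (1 / P) *
        (∫⁻ x in Ioc (-Real.pi) Real.pi, γ x * f x ^ P) ^ (1 / P)) := by
        rw [ENNReal.mul_rpow_of_nonneg _ _ (by positivity),
          ENNReal.mul_rpow_of_nonneg _ _ (by positivity), ← ENNReal.rpow_mul,
          mul_one_div_cancel hP0.ne', ENNReal.rpow_one, ENNReal.ofReal_mul (by norm_num)]
        simp only [ENNReal.ofReal_ofNat]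
        ring
    _ = _ := by
        rw [ENNReal.inv_mul_cancel (by simpa using hρ0) ENNReal.ofReal_ne_top, one_mul]

/-- The adjoint average of `γ` is at most `2A`, and `1 ≤ c⁻¹ γ` turns this bound back into a
multiple of `γ`. -/
theorem avgBound_one {γ : ℝ → ℝ≥0∞} {A : ℝ≥0∞} {c : ℝ≥0} (hc : 0 < c) (hw : IsWeight γ)
    (hA : meanSup γ ≤ A) (hγc : ∀ᵐ x, (c : ℝ≥0∞) ≤ γ x) : AvgBound 1 γ (2 * A * (c : ℝ≥0∞)⁻¹) := by
  intro f hf pf a b ha hb hab hba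
  have hγ := hw.measurable
  set ρ := b - a with hρ
  have hρ0 : 0 < ρ := by simpa [hρ] using hab
  have hc0 : (c : ℝ≥0∞) ≠ 0 := by exact_mod_cast hc.ne'
  have hmass : ∀ x : ℝ, mass γ (x - ρ) (x + ρ) ≤ A * ENNReal.ofReal (2 * ρ) := by
    intro x
    have hlt : x - ρ < x + ρ := by linarith
    rw [mass_eq_mean_mul γ hlt, show x + ρ - (x - ρ) = 2 * ρ by ring]
    gcongr
    refine le_trans ?_ hA
    refine le_iSup_of_le (x - ρ) (le_iSup_of_le (x + ρ) (le_iSup_of_le hlt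
      (le_iSup_of_le ?_ le_rfl)))
    linarith
  have e1 : eLpNorm (avg a b f) 1 (weightedMeasure γ) = (ENNReal.ofReal ρ)⁻¹ *
      eLpNorm (fun x => ∫⁻ u in Ioc a b, f (x + u)) 1 (weightedMeasure γ) :=
    eLpNorm_mul_const_ennreal le_rfl (by simp) (measurable_window hf a b)
  rw [e1, eLpNorm_one_eq_lintegral_enorm, eLpNorm_one_eq_lintegral_enorm]
  simp only [enorm_eq_self]
  rw [lintegral_weightedMeasure hγ _ (measurable_window hf a b), lintegral_weightedMeasure hγ _ hf,
    lintegral_period_window hγ hf hw.periodic pf]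
  calc _ ≤ (ENNReal.ofReal ρ)⁻¹ * ∫⁻ x in Ioc (-Real.pi) Real.pi,
        (A * ENNReal.ofReal (2 * ρ) * (c : ℝ≥0∞)⁻¹) * (γ x * f x) := by
        refine mul_le_mul_right (lintegral_mono_ae ?_) _
        filter_upwards [ae_restrict_of_ae hγc] with x hx
        calc f x * ∫⁻ u in Ioc a b, γ (x - u) ≤ f x * (A * ENNReal.ofReal (2 * ρ)) :=
              mul_le_mul_right ((window_sub_le_mass ha hb x).trans (hmass x)) _
          _ = f x * (A * ENNReal.ofReal (2 * ρ)) * ((c : ℝ≥0∞)⁻¹ * c) := by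
              rw [ENNReal.inv_mul_cancel hc0 ENNReal.coe_ne_top, mul_one]
          _ ≤ f x * (A * ENNReal.ofReal (2 * ρ)) * ((c : ℝ≥0∞)⁻¹ * γ x) := by gcongr
          _ = _ := by ring
    _ = ((ENNReal.ofReal ρ)⁻¹ * ENNReal.ofReal ρ) * (2 * A * (c : ℝ≥0∞)⁻¹ *
        ∫⁻ x in Ioc (-Real.pi) Real.pi, γ x * f x) := by
        rw [lintegral_const_mul _ (by fun_prop), ENNReal.ofReal_mul (by norm_num)]
        simp only [ENNReal.ofReal_ofNat]
        ring
    _ = _ := by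
        rw [ENNReal.inv_mul_cancel (by simpa using hρ0) ENNReal.ofReal_ne_top, one_mul]

theorem ae_of_ae_period {f : ℝ → ℝ≥0∞} (hf : Measurable f)
    (pf : Function.Periodic f (2 * Real.pi)) {M : ℝ≥0∞}
    (h : ∀ᵐ x ∂(volume.restrict (Ioc (-Real.pi) Real.pi)), f x ≤ M) : ∀ᵐ x, f x ≤ M := by
  have hs : MeasurableSet {x | M < f x} := measurableSet_lt measurable_const hf
  -- The weight `∞` on the exceptional set has integral `0` over a period, hence is finite almost
  -- everywhere on the line, which says that the set is null.
  have := ae_lt_top_of_period (γ := {x | M < f x}.indicator fun _ => ∞)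
    (measurable_const.indicator hs) (fun x => by simp [indicator, pf x]) (by
      rw [mass, lintegral_indicator hs, lintegral_const]
      have h0 : volume.restrict (Ioc (-Real.pi) Real.pi) {x | M < f x} = 0 := by
        rw [ae_iff] at h
        simpa only [not_le] using h
      rw [Measure.restrict_apply_univ, h0]
      simp)
  filter_upwards [this] with x hx
  by_contra hlt
  simp [indicator, not_le.1 hlt] at hx

theorem weightedMeasure_of_ae_one {γ : ℝ → ℝ≥0∞} (h : ∀ᵐ x, γ x = 1) :
    weightedMeasure γ = volume.restrict (Ioc (-Real.pi) Real.pi) := by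
  rw [weightedMeasure, withDensity_congr_ae (g := 1) (ae_restrict_of_ae h), withDensity_one]

theorem avgBound_top {γ : ℝ → ℝ≥0∞} (h : ∀ᵐ x, γ x = 1) : AvgBound ∞ γ 1 := by
  intro f hf pf a b ha hb hab hba
  rw [weightedMeasure_of_ae_one h, one_mul, eLpNorm_exponent_top, eLpNorm_exponent_top]
  set M := eLpNormEssSup f (volume.restrict (Ioc (-Real.pi) Real.pi)) with hM
  have h1 : ∀ᵐ x, f x ≤ M := ae_of_ae_period hf pf (by
    filter_upwards [enorm_ae_le_eLpNormEssSup f (volume.restrict (Ioc (-Real.pi) Real.pi))]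
      with x hx using hx)
  refine eLpNormEssSup_le_of_ae_enorm_bound (Filter.Eventually.of_forall fun x => ?_)
  rw [enorm_eq_self, avg, setLIntegral_Ioc_comp_add]
  calc _ ≤ (ENNReal.ofReal (b - a))⁻¹ * ∫⁻ t in Ioc (x + a) (x + b), M :=
        mul_le_mul_right (lintegral_mono_ae (ae_restrict_of_ae h1)) _
    _ = ((ENNReal.ofReal (b - a))⁻¹ * ENNReal.ofReal (b - a)) * M := by
        rw [setLIntegral_const, Real.volume_Ioc, show x + b - (x + a) = b - a by ring]; ring
    _ = M := by
        rw [ENNReal.inv_mul_cancel (by simpa using hab) ENNReal.ofReal_ne_top, one_mul]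

/-- The three kinds of weight are told apart only here; all later estimates depend on `γ` through
`K` alone. -/
theorem exists_avgBound {p : ℝ≥0∞} (hp : 1 ≤ p) (A : ℝ≥0) {c : ℝ≥0} (hc : 0 < c) :
    ∃ K : ℝ≥0, ∀ γ : ℝ → ℝ≥0∞, IsASWeight p γ → weightConst p γ ≤ A →
      (p = 1 → ∀ᵐ x, (c : ℝ≥0∞) ≤ γ x) → AvgBound p γ K := by
  rcases eq_or_ne p 1 with rfl | h1
  · refine ⟨2 * A * c⁻¹, fun γ hγ hA hcγ => ?_⟩
    rw [ENNReal.coe_mul, ENNReal.coe_inv hc.ne']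
    exact avgBound_one hc hγ.weight (by simpa [weightConst] using hA) (hcγ rfl)
  rcases eq_or_ne p ∞ with rfl | h2
  · exact ⟨1, fun γ hγ _ _ => avgBound_top (hγ.top rfl)⟩
  · have hp1 : 1 < p := lt_of_le_of_ne hp h1.symm
    refine ⟨2 * A ^ (1 / p.toReal), fun γ hγ hA _ => ?_⟩
    have hAp := hγ.mid hp1 h2.lt_top
    rw [ENNReal.coe_mul, ENNReal.coe_rpow_of_nonneg _ (by positivity)]
    exact avgBound_of_Ap hp1 h2.lt_top hγ.weight hAp.1.1 (by simpa [weightConst, h1, h2] using hA)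

/-! ### Fourier coefficients and Fourier multipliers -/

noncomputable section

/-- The character `e^{ijx}`. -/
def echar (j : ℤ) (x : ℝ) : ℂ := Complex.exp (Complex.I * ((j * x : ℝ) : ℂ))

/-- Complex-valued `2π`-periodic functions that are integrable over a period. -/
structure PerInt (f : ℝ → ℂ) : Prop where
  measurable : Measurable f
  periodic : Function.Periodic f (2 * Real.pi)
  integrable : ∀ a b : ℝ, IntervalIntegrable f volume a b

/-- The complex Fourier coefficient. -/
def coef (f : ℝ → ℂ) (j : ℤ) : ℂ :=
  (1 / (2 * Real.pi) : ℂ) * ∫ t in (-Real.pi)..Real.pi, echar (-j) t * f t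

/-- The Fourier multiplier operator with symbol `q`. -/
def mult (q : ℤ → ℂ) (f : ℝ → ℂ) (x : ℝ) : ℂ := ∑' j, q j * coef f j * echar j x

/-- The Steklov mean of a complex-valued function. -/
def cstek (v : ℝ) (f : ℝ → ℂ) (x : ℝ) : ℂ := (1 / v : ℂ) * ∫ t in x..(x + v), f t

/-- The symbol of the Steklov mean. -/
def stekSymbol (v : ℝ) (j : ℤ) : ℂ := (1 / v : ℂ) * ∫ u in (0 : ℝ)..v, echar j u

theorem echar_add_right (j : ℤ) (x y : ℝ) : echar j (x + y) = echar j x * echar j y := by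
  rw [echar, echar, echar, ← Complex.exp_add]
  congr 1; push_cast; ring

theorem echar_add_left (j k : ℤ) (x : ℝ) : echar (j + k) x = echar j x * echar k x := by
  rw [echar, echar, echar, ← Complex.exp_add]
  congr 1; push_cast; ring

theorem echar_neg (j : ℤ) (x : ℝ) : echar (-j) x = echar j (-x) := by
  simp [echar]

@[simp] theorem echar_zero (x : ℝ) : echar 0 x = 1 := by simp [echar]

@[simp] theorem echar_zero_right (j : ℤ) : echar j 0 = 1 := by simp [echar]

@[simp] theorem norm_echar (j : ℤ) (x : ℝ) : ‖echar j x‖ = 1 := by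
  rw [echar, mul_comm, Complex.norm_exp_ofReal_mul_I]

theorem continuous_echar (j : ℤ) : Continuous (echar j) := by
  unfold echar; fun_prop

theorem measurable_echar (j : ℤ) : Measurable (echar j) := (continuous_echar j).measurable

theorem periodic_echar (j : ℤ) : Function.Periodic (echar j) (2 * Real.pi) := by
  intro x
  rw [echar, echar, Complex.exp_eq_exp_iff_exists_int]
  exact ⟨j, by push_cast; ring⟩

theorem hasDerivAt_echar (j : ℤ) (x : ℝ) :
    HasDerivAt (echar j) (Complex.I * j * echar j x) x := by
  have h1 : HasDerivAt (fun y : ℝ => Complex.I * ((j * y : ℝ) : ℂ)) (Complex.I * j) x := by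
    have : HasDerivAt (fun y : ℝ => (j * y : ℝ)) (j : ℝ) x := by
      simpa using (hasDerivAt_id x).const_mul (j : ℝ)
    have := this.ofReal_comp.const_mul Complex.I
    simpa using this
  have := h1.cexp
  rw [mul_comm] at this
  exact this

theorem integral_echar {j : ℤ} (hj : j ≠ 0) (a b : ℝ) :
    ∫ t in a..b, echar j t = (echar j b - echar j a) / (Complex.I * j) := by
  have hne : Complex.I * (j : ℂ) ≠ 0 := mul_ne_zero Complex.I_ne_zero (by exact_mod_cast hj)
  have h : ∀ x ∈ uIcc a b,
      HasDerivAt (fun y => echar j y / (Complex.I * j)) (echar j x) x := fun x _ => by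
    have := (hasDerivAt_echar j x).div_const (Complex.I * j)
    rwa [mul_div_cancel_left₀ _ hne] at this
  rw [intervalIntegral.integral_eq_sub_of_hasDerivAt h
    ((continuous_echar j).intervalIntegrable _ _), sub_div]

theorem integral_echar_period {j : ℤ} (hj : j ≠ 0) :
    ∫ t in (-Real.pi)..Real.pi, echar j t = 0 := by
  rw [integral_echar hj]
  have := periodic_echar j (-Real.pi)
  rw [show -Real.pi + 2 * Real.pi = Real.pi by ring] at this
  rw [this, sub_self, zero_div]

theorem stekSymbol_of_ne_zero {v : ℝ} {j : ℤ} (hj : j ≠ 0) :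
    stekSymbol v j = (echar j v - 1) / (Complex.I * ((j * v : ℝ) : ℂ)) := by
  rw [stekSymbol, integral_echar hj, echar_zero_right, div_mul_div_comm, one_mul]
  congr 1; push_cast; ring

theorem PerInt.of_continuous {f : ℝ → ℂ} (hf : Continuous f)
    (hp : Function.Periodic f (2 * Real.pi)) : PerInt f :=
  ⟨hf.measurable, hp, fun a b => hf.intervalIntegrable a b⟩

theorem PerInt.sub {f g : ℝ → ℂ} (hf : PerInt f) (hg : PerInt g) : PerInt (f - g) :=
  ⟨hf.measurable.sub hg.measurable, fun x => by simp [hf.periodic x, hg.periodic x],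
    fun a b => (hf.integrable a b).sub (hg.integrable a b)⟩

theorem PerInt.add {f g : ℝ → ℂ} (hf : PerInt f) (hg : PerInt g) : PerInt (f + g) :=
  ⟨hf.measurable.add hg.measurable, fun x => by simp [hf.periodic x, hg.periodic x],
    fun a b => (hf.integrable a b).add (hg.integrable a b)⟩

theorem PerInt.echar_mul {f : ℝ → ℂ} (hf : PerInt f) (j : ℤ) :
    PerInt (fun t => echar j t * f t) :=
  ⟨(measurable_echar j).mul hf.measurable,
    fun x => by simp only [hf.periodic x, periodic_echar j x],
    fun a b => (hf.integrable a b).continuousOn_mul (continuous_echar j).continuousOn⟩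

theorem PerInt.comp_add {f : ℝ → ℂ} (hf : PerInt f) (u : ℝ) : PerInt (fun t => f (t + u)) :=
  ⟨hf.measurable.comp (measurable_id.add_const u),
    fun x => by rw [show x + 2 * Real.pi + u = x + u + 2 * Real.pi by ring, hf.periodic],
    fun a b => by simpa using (hf.integrable (a + u) (b + u)).comp_add_right u⟩

theorem integral_period_comp_add {E : Type*} [NormedAddCommGroup E] [NormedSpace ℝ E]
    {g : ℝ → E} (hg : Function.Periodic g (2 * Real.pi)) (u : ℝ) :
    ∫ x in (-Real.pi)..Real.pi, g (x + u) = ∫ x in (-Real.pi)..Real.pi, g x := by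
  rw [intervalIntegral.integral_comp_add_right]
  have := hg.intervalIntegral_add_eq (-Real.pi + u) (-Real.pi)
  rwa [show -Real.pi + u + 2 * Real.pi = Real.pi + u by ring,
    show -Real.pi + 2 * Real.pi = Real.pi by ring] at this

theorem coef_sub {f g : ℝ → ℂ} (hf : PerInt f) (hg : PerInt g) (j : ℤ) :
    coef (f - g) j = coef f j - coef g j := by
  rw [coef, coef, coef, ← mul_sub, ← intervalIntegral.integral_sub
    ((hf.echar_mul _).integrable _ _) ((hg.echar_mul _).integrable _ _)]
  simp [mul_sub]

theorem norm_coef_le {f : ℝ → ℂ} (j : ℤ) :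
    ‖coef f j‖ ≤ 1 / (2 * Real.pi) * ∫ t in (-Real.pi)..Real.pi, ‖f t‖ := by
  rw [coef, norm_mul]
  have h1 : ‖(1 / (2 * Real.pi) : ℂ)‖ = 1 / (2 * Real.pi) := by
    rw [show (1 / (2 * Real.pi) : ℂ) = ((1 / (2 * Real.pi) : ℝ) : ℂ) by push_cast; rfl,
      Complex.norm_real, Real.norm_of_nonneg (by positivity)]
  rw [h1]
  gcongr
  refine (intervalIntegral.norm_integral_le_integral_norm (by linarith [Real.pi_pos])).trans ?_
  simp

theorem coef_comp_add {f : ℝ → ℂ} (hf : PerInt f) (u : ℝ) (j : ℤ) :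
    coef (fun t => f (t + u)) j = echar j u * coef f j := by
  have h : ∫ t in (-Real.pi)..Real.pi, echar (-j) t * f (t + u) =
      echar j u * ∫ t in (-Real.pi)..Real.pi, echar (-j) t * f t := by
    rw [← integral_period_comp_add ((hf.echar_mul (-j)).periodic) u,
      ← intervalIntegral.integral_const_mul]
    refine intervalIntegral.integral_congr fun t _ => ?_
    rw [echar_add_right, echar_neg j u]
    have : echar j u * echar j (-u) = 1 := by
      rw [← echar_add_right, add_neg_cancel, echar_zero_right]
    linear_combination (-(echar (-j) t) * f (t + u)) * this
  rw [coef, coef, h, mul_left_comm]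

theorem continuous_cstek {f : ℝ → ℂ} (hf : PerInt f) (v : ℝ) : Continuous (cstek v f) := by
  have h := intervalIntegral.continuous_primitive hf.integrable 0
  have : cstek v f = fun x => (1 / v : ℂ) *
      ((∫ t in (0 : ℝ)..(x + v), f t) - ∫ t in (0 : ℝ)..x, f t) := by
    ext x
    rw [cstek, intervalIntegral.integral_interval_sub_left (hf.integrable _ _) (hf.integrable _ _)]
  rw [this]
  exact continuous_const.mul ((h.comp (continuous_id.add continuous_const)).sub h)

theorem cstek_eq (v : ℝ) (f : ℝ → ℂ) (x : ℝ) :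
    cstek v f x = (1 / v : ℂ) * ∫ u in (0 : ℝ)..v, f (x + u) := by
  rw [cstek, intervalIntegral.integral_comp_add_left, add_zero]

theorem PerInt.cstek {f : ℝ → ℂ} (hf : PerInt f) (v : ℝ) : PerInt (cstek v f) :=
  PerInt.of_continuous (continuous_cstek hf v) fun x => by
    rw [cstek_eq, cstek_eq]
    congr 2
    ext u
    rw [show x + 2 * Real.pi + u = x + u + 2 * Real.pi by ring, hf.periodic]

/-- The Steklov mean averages translates of `f`, and translation by `u` multiplies the `j`-th
coefficient by `echar j u`; Fubini allows averaging these factors. -/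
theorem coef_cstek {f : ℝ → ℂ} (hf : PerInt f) {v : ℝ} (hv : 0 < v) (j : ℤ) :
    coef (cstek v f) j = stekSymbol v j * coef f j := by
  have hπ : -Real.pi ≤ Real.pi := by linarith [Real.pi_pos]
  have hint : Integrable (fun z : ℝ × ℝ => echar (-j) z.1 * f (z.1 + z.2))
      ((volume.restrict (Ioc (-Real.pi) Real.pi)).prod (volume.restrict (Ioc 0 v))) := by
    have hm : Measurable fun z : ℝ × ℝ => echar (-j) z.1 * f (z.1 + z.2) :=
      ((measurable_echar _).comp measurable_fst).mul
        (hf.measurable.comp (measurable_fst.add measurable_snd))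
    rw [integrable_prod_iff' hm.aestronglyMeasurable]
    constructor
    · refine Filter.Eventually.of_forall fun u => ?_
      have := ((hf.comp_add u).echar_mul (-j)).integrable (-Real.pi) Real.pi
      rwa [intervalIntegrable_iff_integrableOn_Ioc_of_le hπ] at this
    · have : ∀ u : ℝ, ∫ x in Ioc (-Real.pi) Real.pi, ‖echar (-j) x * f (x + u)‖ =
          ∫ x in (-Real.pi)..Real.pi, ‖f x‖ := by
        intro u
        simp only [norm_mul, norm_echar, one_mul]
        rw [← intervalIntegral.integral_of_le hπ]
        exact integral_period_comp_add (g := fun x => ‖f x‖) (fun x => by simp only [hf.periodic x]) u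
      simp only [this]
      exact integrable_const _
  have swap := integral_integral_swap (f := fun x u => echar (-j) x * f (x + u)) hint
  have h1 : ∀ u : ℝ, ∫ x in Ioc (-Real.pi) Real.pi, echar (-j) x * f (x + u) =
      echar j u * (2 * Real.pi * coef f j) := by
    intro u
    rw [← intervalIntegral.integral_of_le hπ]
    have := coef_comp_add hf u j
    rw [coef] at this
    have hpi : (Real.pi : ℂ) ≠ 0 := by exact_mod_cast Real.pi_ne_zero
    field_simp at this
    linear_combination this
  rw [coef]
  simp only [cstek_eq]
  have h2 : ∀ x : ℝ, echar (-j) x * ((1 / v : ℂ) * ∫ u in (0 : ℝ)..v, f (x + u)) =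
      (1 / v : ℂ) * ∫ u in (0 : ℝ)..v, echar (-j) x * f (x + u) := by
    intro x
    rw [intervalIntegral.integral_const_mul]; ring
  simp only [h2]
  rw [intervalIntegral.integral_const_mul, intervalIntegral.integral_of_le hπ]
  simp only [intervalIntegral.integral_of_le hv.le]
  rw [swap]
  simp only [h1]
  rw [stekSymbol, intervalIntegral.integral_of_le hv.le, integral_mul_const]
  have hpi : (Real.pi : ℂ) ≠ 0 := by exact_mod_cast Real.pi_ne_zero
  field_simp

/-! ### Multipliers with absolutely summable symbols, and uniqueness of Fourier series. -/

theorem summable_mult_term {q : ℤ → ℂ} (hq : Summable fun j => ‖q j‖) (f : ℝ → ℂ) :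
    Summable fun j => ‖q j * coef f j‖ := by
  refine Summable.of_nonneg_of_le (fun _ => norm_nonneg _) (fun j => ?_)
    (hq.mul_right (1 / (2 * Real.pi) * ∫ t in (-Real.pi)..Real.pi, ‖f t‖))
  rw [norm_mul]
  gcongr
  exact norm_coef_le j

theorem PerInt.series {c : ℤ → ℂ} (hc : Summable fun j => ‖c j‖) :
    Continuous (fun x => ∑' j, c j * echar j x) ∧ PerInt fun x => ∑' j, c j * echar j x := by
  have h : Continuous (fun x => ∑' j, c j * echar j x) :=
    continuous_tsum (fun j => continuous_const.mul (continuous_echar j)) hc fun j x => by simp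
  exact ⟨h, PerInt.of_continuous h fun x => by simp only [periodic_echar _ x]⟩

theorem coef_series {c : ℤ → ℂ} (hc : Summable fun j => ‖c j‖) (j : ℤ) :
    coef (fun x => ∑' k, c k * echar k x) j = c j := by
  have hs := intervalIntegral.hasSum_intervalIntegral_of_summable_norm (a := -Real.pi) (b := Real.pi)
    (f := fun k : ℤ => (⟨fun t => c k * echar (k - j) t,
      continuous_const.mul (continuous_echar _)⟩ : C(ℝ, ℂ))) (by
    refine Summable.of_nonneg_of_le (fun _ => norm_nonneg _) (fun k => ?_) hc
    rw [ContinuousMap.norm_le _ (norm_nonneg _)]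
    intro x
    simp)
  rw [coef]
  have e : ∀ t : ℝ, echar (-j) t * ∑' k, c k * echar k t = ∑' k, c k * echar (k - j) t := by
    intro t
    rw [← tsum_mul_left]
    congr 1; ext k
    rw [sub_eq_add_neg, echar_add_left]; ring
  simp only [e]
  simp only [ContinuousMap.coe_mk] at hs
  rw [← hs.tsum_eq, tsum_eq_single j]
  · simp
    have hpi : (Real.pi : ℂ) ≠ 0 := by exact_mod_cast Real.pi_ne_zero
    field_simp
    norm_num
  · intro k hk
    rw [intervalIntegral.integral_const_mul, integral_echar_period (sub_ne_zero.2 hk), mul_zero]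

theorem PerInt.mult {q : ℤ → ℂ} (hq : Summable fun j => ‖q j‖) (f : ℝ → ℂ) : PerInt (mult q f) :=
  (PerInt.series (summable_mult_term hq f)).2

theorem continuous_mult {q : ℤ → ℂ} (hq : Summable fun j => ‖q j‖) (f : ℝ → ℂ) :
    Continuous (mult q f) := (PerInt.series (summable_mult_term hq f)).1

theorem coef_mult {q : ℤ → ℂ} (hq : Summable fun j => ‖q j‖) (f : ℝ → ℂ) (j : ℤ) :
    coef (mult q f) j = q j * coef f j := coef_series (summable_mult_term hq f) j

theorem eq_series_of_summable {g : ℝ → ℂ} (hg : Continuous g)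
    (pg : Function.Periodic g (2 * Real.pi)) (hs : Summable fun j => ‖coef g j‖) (x : ℝ) :
    g x = ∑' j, coef g j * echar j x := by
  have : Fact (0 < 2 * Real.pi) := ⟨Real.two_pi_pos⟩
  let F : C(AddCircle (2 * Real.pi), ℂ) := ⟨pg.lift, continuous_coinduced_dom.2 hg⟩
  have hF : ∀ t : ℝ, F (t : AddCircle (2 * Real.pi)) = g t := fun t => pg.lift_coe t
  have he : ∀ (j : ℤ) (t : ℝ), fourier j (t : AddCircle (2 * Real.pi)) = echar j t := by
    intro j t
    rw [fourier_coe_apply, echar]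
    congr 1
    have hpi : (Real.pi : ℂ) ≠ 0 := by exact_mod_cast Real.pi_ne_zero
    push_cast
    field_simp
  have hc : ∀ j, fourierCoeff F j = coef g j := by
    intro j
    rw [fourierCoeff_eq_intervalIntegral F j (-Real.pi),
      show -Real.pi + 2 * Real.pi = Real.pi by ring, coef]
    simp only [he, hF, smul_eq_mul, Complex.real_smul]
    push_cast
    rfl
  have hc' : Summable (fourierCoeff F) := by
    rw [funext hc]
    exact summable_norm_iff.1 hs
  have := has_pointwise_sum_fourier_series_of_summable hc' (x : AddCircle (2 * Real.pi))
  simp only [hc, he, hF, smul_eq_mul] at this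
  exact this.tsum_eq.symm

/-- Through this lemma the operator identities below become identities between symbols. -/
theorem eq_of_coef_eq {f g : ℝ → ℂ} (hf : Continuous f) (hg : Continuous g)
    (pf : Function.Periodic f (2 * Real.pi)) (pg : Function.Periodic g (2 * Real.pi))
    (hs : Summable fun j => ‖coef g j‖) (h : ∀ j, coef f j = coef g j) : f = g := by
  ext x
  rw [eq_series_of_summable hf pf (by simpa only [h] using hs), eq_series_of_summable hg pg hs]
  simp only [h]

end

/-! ### Boundedness of Fourier multipliers on weighted spaces -/

/-- The size conditions on a symbol `q` at scale `n` which make its multiplier operator bounded. -/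
structure SymbolBound (q : ℤ → ℂ) (n : ℕ) (B : ℝ) : Prop where
  summable : Summable fun j => ‖q j‖
  sum_le : ∑' j, ‖q j‖ ≤ B * n
  sum_diff_le : ∑' j, ‖q (j + 2) - 2 * q (j + 1) + q j‖ ≤ B / n

theorem mult_eq_integral {q : ℤ → ℂ} (hq : Summable fun j => ‖q j‖) {f : ℝ → ℂ} (hf : PerInt f)
    (x : ℝ) : mult q f x = (1 / (2 * Real.pi) : ℂ) *
      ∫ t in (-Real.pi)..Real.pi, (∑' j, q j * echar j (x - t)) * f t := by
  have hπ : -Real.pi ≤ Real.pi := by linarith [Real.pi_pos]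
  have hint : ∀ j : ℤ, IntervalIntegrable (fun t => q j * echar j x * (echar (-j) t * f t)) volume
      (-Real.pi) Real.pi := fun j => ((hf.echar_mul (-j)).integrable _ _).const_mul _
  have h := hasSum_integral_of_summable_integral_norm
    (μ := volume.restrict (Ioc (-Real.pi) Real.pi))
    (F := fun (j : ℤ) t => q j * echar j x * (echar (-j) t * f t))
    (fun j => (intervalIntegrable_iff_integrableOn_Ioc_of_le hπ).1 (hint j)) (by
      simp only [norm_mul, norm_echar, mul_one, one_mul]
      simp_rw [integral_const_mul]
      exact hq.mul_right _)
  rw [intervalIntegral.integral_of_le hπ]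
  have e : ∀ t : ℝ, (∑' j, q j * echar j (x - t)) * f t =
      ∑' j, q j * echar j x * (echar (-j) t * f t) := by
    intro t
    rw [← tsum_mul_right]
    congr 1; ext j
    rw [sub_eq_add_neg, echar_add_right, echar_neg]; ring
  simp only [e]
  rw [← h.tsum_eq, ← tsum_mul_left, mult]
  congr 1; ext j
  rw [coef, ← intervalIntegral.integral_of_le hπ, intervalIntegral.integral_const_mul]
  ring

theorem norm_kernel_le {q : ℤ → ℂ} (hq : Summable fun j => ‖q j‖) (y : ℝ) :
    ‖∑' j, q j * echar j y‖ ≤ ∑' j, ‖q j‖ := by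
  refine (norm_tsum_le_tsum_norm (by simpa using hq)).trans_eq ?_
  simp

/-- Summation by parts: shifting the symbol by `k` multiplies the kernel by `e^{-iky}`, so a second
difference gives the square of `e^{-iy} - 1`. -/
theorem kernel_diff {q : ℤ → ℂ} (hq : Summable fun j => ‖q j‖) (y : ℝ) :
    ∑' j, (q (j + 2) - 2 * q (j + 1) + q j) * echar j y =
      (echar (-1) y - 1) ^ 2 * ∑' j, q j * echar j y := by
  have hs : Summable fun j => q j * echar j y := by
    refine Summable.of_norm ?_
    simpa using hq
  have hk : ∀ k : ℤ, Summable (fun j => q (j + k) * echar j y) ∧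
      ∑' j, q (j + k) * echar j y = echar (-k) y * ∑' j, q j * echar j y := by
    intro k
    have e : ∀ j, q (j + k) * echar j y = echar (-k) y * (q (j + k) * echar (j + k) y) := by
      intro j
      have h1 : echar j y = echar (-k) y * echar (j + k) y := by
        rw [← echar_add_left]; congr 1; ring
      rw [h1]; ring
    have hs' : Summable fun j => q (j + k) * echar (j + k) y :=
      (Equiv.addRight k).summable_iff.2 hs
    constructor
    · simp only [e]; exact hs'.mul_left _
    · simp only [e]
      rw [tsum_mul_left]
      congr 1
      exact (Equiv.addRight k).tsum_eq fun j => q j * echar j y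
  have h2 := hk 2
  have h1 := hk 1
  have e : ∀ j, (q (j + 2) - 2 * q (j + 1) + q j) * echar j y =
      q (j + 2) * echar j y - 2 * (q (j + 1) * echar j y) + q j * echar j y := fun j => by ring
  simp only [e]
  rw [(h2.1.sub (h1.1.mul_left 2)).tsum_add hs, h2.1.tsum_sub (h1.1.mul_left 2), tsum_mul_left,
    h2.2, h1.2, show (-2 : ℤ) = -1 + -1 by norm_num, echar_add_left]
  ring

theorem norm_echar_neg_one_sub_one (y : ℝ) : ‖echar (-1) y - 1‖ = 2 * |Real.sin (y / 2)| := by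
  rw [echar_neg, echar, Complex.norm_exp_I_mul_ofReal_sub_one]
  simp [neg_div]

/-- On `|y| ≤ π` one has `|e^{-iy} - 1| = 2 |sin(y/2)| ≥ 2|y|/π`, and `3` is an upper bound for
`π²/4`. -/
theorem norm_kernel_le_sq {q : ℤ → ℂ} (hq : Summable fun j => ‖q j‖) {y : ℝ}
    (hy : |y| ≤ Real.pi) :
    ‖∑' j, q j * echar j y‖ * y ^ 2 ≤ 3 * ∑' j, ‖q (j + 2) - 2 * q (j + 1) + q j‖ := by
  have hs : Summable fun j => ‖q (j + 2) - 2 * q (j + 1) + q j‖ := by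
    have h2 : Summable fun j => ‖q (j + 2)‖ := hq.comp_injective (add_left_injective 2)
    have h1 : Summable fun j => ‖q (j + 1)‖ := hq.comp_injective (add_left_injective 1)
    refine Summable.of_nonneg_of_le (fun _ => norm_nonneg _) (fun j => ?_)
      ((h2.add (h1.mul_left 2)).add hq)
    refine (norm_add_le _ _).trans (add_le_add_left ((norm_sub_le _ _).trans ?_) _)
    simp
  have h : ‖echar (-1) y - 1‖ ^ 2 * ‖∑' j, q j * echar j y‖ ≤
      ∑' j, ‖q (j + 2) - 2 * q (j + 1) + q j‖ := by
    rw [← norm_pow, ← norm_mul, ← kernel_diff hq]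
    refine (norm_tsum_le_tsum_norm (by simpa using hs)).trans_eq ?_
    simp
  have hsin : |y| / Real.pi ≤ |Real.sin (y / 2)| := by
    have := Real.mul_abs_le_abs_sin (x := y / 2) (by
      rw [abs_div, abs_two]; linarith)
    rw [abs_div, abs_two] at this
    refine le_trans (le_of_eq ?_) this
    field_simp
  have hy2 : y ^ 2 ≤ 3 * ‖echar (-1) y - 1‖ ^ 2 := by
    rw [norm_echar_neg_one_sub_one]
    have hπ := Real.pi_pos
    rw [div_le_iff₀ hπ] at hsin
    have h3 : Real.pi ^ 2 ≤ 12 := by nlinarith [Real.pi_lt_d2]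
    calc y ^ 2 = |y| ^ 2 := (sq_abs y).symm
      _ ≤ (|Real.sin (y / 2)| * Real.pi) ^ 2 := by gcongr
      _ = Real.pi ^ 2 * |Real.sin (y / 2)| ^ 2 := by ring
      _ ≤ 12 * |Real.sin (y / 2)| ^ 2 := by gcongr
      _ = _ := by ring
  calc _ ≤ ‖∑' j, q j * echar j y‖ * (3 * ‖echar (-1) y - 1‖ ^ 2) := by gcongr
    _ = 3 * (‖echar (-1) y - 1‖ ^ 2 * ‖∑' j, q j * echar j y‖) := by ring
    _ ≤ _ := by gcongr

/-- The dyadic radii `min (2 ^ i / n) π`. -/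
noncomputable def dyadicRadius (n i : ℕ) : ℝ := min (2 ^ i / n) Real.pi

theorem dyadicRadius_pos {n : ℕ} (hn : 1 ≤ n) (i : ℕ) : 0 < dyadicRadius n i := by
  have : (0 : ℝ) < n := by exact_mod_cast hn
  exact lt_min (by positivity) Real.pi_pos

/-- Take the least `i` with `|u| < 2^i/n`. If `i > 0`, then `|u| ≥ 2^{i-1}/n`, and the quadratic
bound gives `k ≤ 12 B n / 4^i`: one factor `2^{-i}` is the gain, the other goes with `n` into the
inverse radius. For `i = 0` the bound `B n` suffices. -/
theorem le_dyadic_sum {n : ℕ} (hn : 1 ≤ n) {I : ℕ} (hI : Real.pi * n < 2 ^ I) {B k u : ℝ}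
    (hB : 0 ≤ B) (h1 : k ≤ B * n) (h2 : k * u ^ 2 ≤ 3 * (B / n))
    (hu : u ∈ Ioc (-Real.pi) Real.pi) :
    ∃ i ∈ Finset.range (I + 1), u ∈ Ioc (-dyadicRadius n i) (dyadicRadius n i) ∧
      k ≤ 12 * B * (1 / 2) ^ i * (dyadicRadius n i)⁻¹ := by
  have hn0 : (0 : ℝ) < n := by exact_mod_cast hn
  have habs : |u| ≤ Real.pi := abs_le.2 ⟨hu.1.le, hu.2⟩
  have hex : ∃ i : ℕ, |u| < 2 ^ i / n := ⟨I, by rw [lt_div_iff₀ hn0]; nlinarith⟩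
  classical
  set i := Nat.find hex with hi
  have hlt : |u| < 2 ^ i / n := Nat.find_spec hex
  have hiI : i ≤ I := Nat.find_min' hex (by rw [lt_div_iff₀ hn0]; nlinarith)
  have hρ := dyadicRadius_pos hn i
  have hinv : n / 2 ^ i ≤ (dyadicRadius n i)⁻¹ := by
    rw [← inv_div]
    exact inv_anti₀ hρ (min_le_left _ _)
  refine ⟨i, Finset.mem_range.2 (by omega), ⟨?_, ?_⟩, ?_⟩
  · rw [dyadicRadius, neg_lt, lt_min_iff]
    exact ⟨(neg_le_abs u).trans_lt hlt, by linarith [hu.1]⟩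
  · rw [dyadicRadius, le_min_iff]
    exact ⟨((le_abs_self u).trans_lt hlt).le, hu.2⟩
  · have hpow : (0 : ℝ) < 2 ^ i := by positivity
    refine le_trans ?_ (mul_le_mul_of_nonneg_left hinv (by positivity))
    rcases Nat.eq_zero_or_pos i with h0 | h0
    · rw [h0]
      simp only [pow_zero, mul_one, div_one]
      nlinarith [mul_nonneg hB hn0.le]
    · have hge : 2 ^ (i - 1) / (n : ℝ) ≤ |u| := not_lt.1 (Nat.find_min hex (by omega))
      have hge2 : 2 ^ i / (2 * (n : ℝ)) ≤ |u| := by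
        refine le_trans (le_of_eq ?_) hge
        nth_rewrite 1 [show i = (i - 1) + 1 by omega]
        rw [pow_succ]; field_simp
      have hu2 : (2 ^ i / (2 * (n : ℝ))) ^ 2 ≤ u ^ 2 := by
        rw [← sq_abs u]; gcongr
      rcases le_or_gt k 0 with hk | hk
      · exact hk.trans (by positivity)
      · have h3 : k * (2 ^ i / (2 * (n : ℝ))) ^ 2 ≤ 3 * (B / n) :=
          (mul_le_mul_of_nonneg_left hu2 hk.le).trans h2
        have h4 : k = (k * (2 ^ i / (2 * (n : ℝ))) ^ 2) * (4 * n ^ 2 / (2 ^ i) ^ 2) := by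
          field_simp; norm_num
        rw [h4]
        calc _ ≤ 3 * (B / n) * (4 * n ^ 2 / (2 ^ i) ^ 2) := by gcongr
          _ = _ := by rw [one_div, inv_pow]; field_simp; ring

theorem eLpNorm_const_mul_ennreal {α : Type*} [MeasurableSpace α] {μ : Measure α} {p : ℝ≥0∞}
    {f : α → ℝ≥0∞} (c : ℝ≥0∞) (hp : 1 ≤ p) (hf : Measurable f) :
    eLpNorm (fun x => c * f x) p μ = c * eLpNorm f p μ := by
  rcases eq_or_ne p ∞ with rfl | h
  · simp only [eLpNorm_exponent_top, eLpNormEssSup, enorm_eq_self]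
    exact ENNReal.essSup_const_mul
  · exact eLpNorm_mul_const_ennreal hp h hf

theorem SymbolBound.nonneg {q : ℤ → ℂ} {n : ℕ} {B : ℝ} (hn : 1 ≤ n) (h : SymbolBound q n B) :
    0 ≤ B := by
  have h1 : 0 ≤ B * n := (tsum_nonneg fun _ => norm_nonneg _).trans h.sum_le
  have hn0 : (0 : ℝ) < n := by exact_mod_cast hn
  exact nonneg_of_mul_nonneg_left h1 hn0

theorem enorm_mult_le {q : ℤ → ℂ} {n : ℕ} {B : ℝ} (hn : 1 ≤ n) (hq : SymbolBound q n B)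
    {f : ℝ → ℂ} (hf : PerInt f) {I : ℕ} (hI : Real.pi * n < 2 ^ I) (x : ℝ) :
    ‖mult q f x‖ₑ ≤ ∑ i ∈ Finset.range (I + 1), ENNReal.ofReal (12 * B * (1 / 2) ^ i) *
      (avg (-dyadicRadius n i) 0 (fun t => ‖f t‖ₑ) x +
        avg 0 (dyadicRadius n i) (fun t => ‖f t‖ₑ) x) := by
  have hπ : -Real.pi ≤ Real.pi := by linarith [Real.pi_pos]
  have hB := hq.nonneg hn
  set K : ℝ → ℂ := fun y => ∑' j, q j * echar j y with hK
  have hKs := PerInt.series hq.summable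
  have mf := hf.measurable
  have hc : ‖(1 / (2 * Real.pi) : ℂ)‖ₑ ≤ 1 := by
    rw [← ofReal_norm]
    refine ENNReal.ofReal_le_one.2 ?_
    rw [show (1 / (2 * Real.pi) : ℂ) = ((1 / (2 * Real.pi) : ℝ) : ℂ) by push_cast; rfl,
      Complex.norm_real, Real.norm_of_nonneg (by positivity)]
    rw [div_le_one Real.two_pi_pos]
    linarith [Real.pi_gt_three]
  have h1 : ‖mult q f x‖ₑ ≤ ∫⁻ t in Ioc (-Real.pi) Real.pi, ‖K (x - t)‖ₑ * ‖f t‖ₑ := by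
    rw [mult_eq_integral hq.summable hf, enorm_mul, intervalIntegral.integral_of_le hπ]
    calc _ ≤ 1 * ∫⁻ t in Ioc (-Real.pi) Real.pi, ‖(∑' j, q j * echar j (x - t)) * f t‖ₑ := by
          gcongr
          exact enorm_integral_le_lintegral_enorm _
      _ = _ := by simp only [one_mul, enorm_mul, hK]
  have h2 : ∫⁻ t in Ioc (-Real.pi) Real.pi, ‖K (x - t)‖ₑ * ‖f t‖ₑ =
      ∫⁻ u in Ioc (-Real.pi) Real.pi, ‖K (-u)‖ₑ * ‖f (x + u)‖ₑ := by
    rw [← lintegral_period_comp_sub (f := fun t => ‖K (x - t)‖ₑ * ‖f t‖ₑ) ?_ (-x)]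
    · congr 1; ext u
      rw [show x - (u - -x) = -u by ring, show u - -x = x + u by ring]
    · intro t
      simp only [hf.periodic t]
      rw [show x - (t + 2 * Real.pi) = x - t - 2 * Real.pi by ring,
        show K (x - t - 2 * Real.pi) = K (x - t) from hKs.2.periodic.sub_eq _]
  refine (h1.trans h2.le).trans ?_
  have h3 : ∀ u ∈ Ioc (-Real.pi) Real.pi, ‖K (-u)‖ₑ * ‖f (x + u)‖ₑ ≤
      ∑ i ∈ Finset.range (I + 1), ENNReal.ofReal (12 * B * (1 / 2) ^ i) *
        ((ENNReal.ofReal (dyadicRadius n i))⁻¹ *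
        (Ioc (-dyadicRadius n i) (dyadicRadius n i)).indicator (fun u => ‖f (x + u)‖ₑ) u) := by
    intro u hu
    have hu' : |(-u)| ≤ Real.pi := by rw [abs_neg]; exact abs_le.2 ⟨hu.1.le, hu.2⟩
    obtain ⟨i, hi, hui, hk⟩ := le_dyadic_sum hn hI (k := ‖K (-u)‖) (u := u) hB
      ((norm_kernel_le hq.summable _).trans hq.sum_le) (by
        have := norm_kernel_le_sq hq.summable hu'
        rw [neg_sq] at this
        exact this.trans (by gcongr; exact hq.sum_diff_le)) hu
    refine le_trans ?_ (Finset.single_le_sum (fun _ _ => zero_le) hi)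
    rw [indicator_of_mem hui, ← mul_assoc, ← ofReal_norm]
    gcongr
    rw [← ENNReal.ofReal_inv_of_pos (dyadicRadius_pos hn i), ← ENNReal.ofReal_mul (by positivity)]
    exact ENNReal.ofReal_le_ofReal hk
  refine (setLIntegral_mono' measurableSet_Ioc h3).trans ?_
  rw [lintegral_finsetSum _ fun i _ => ?_]
  · refine Finset.sum_le_sum fun i _ => ?_
    have hρ := dyadicRadius_pos hn i
    have mi : Measurable
        ((Ioc (-dyadicRadius n i) (dyadicRadius n i)).indicator (fun u => ‖f (x + u)‖ₑ)) :=
      Measurable.indicator (by fun_prop) measurableSet_Ioc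
    rw [lintegral_const_mul _ (mi.const_mul _), lintegral_const_mul _ mi]
    refine mul_le_mul_right ?_ _
    rw [avg, avg, sub_neg_eq_add, zero_add, sub_zero, ← mul_add]
    refine mul_le_mul_right ?_ _
    refine (setLIntegral_le_lintegral _ _).trans ?_
    -- The symmetric window may have length `2π`, too long for `AvgBound`; its two halves are
    -- admissible.
    rw [lintegral_indicator measurableSet_Ioc,
      ← Ioc_union_Ioc_eq_Ioc (neg_nonpos.2 hρ.le) hρ.le]
    exact lintegral_union_le _ _ _
  · have mi : Measurable
        ((Ioc (-dyadicRadius n i) (dyadicRadius n i)).indicator (fun u => ‖f (x + u)‖ₑ)) :=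
      Measurable.indicator (by fun_prop) measurableSet_Ioc
    exact (mi.const_mul _).const_mul _

/-- The constant `48` is `12` from the dyadic bound, times `2` for the two half-windows, times `2`
for the geometric series; it depends neither on `n` nor on the number of dyadic scales. -/
theorem eLpNorm_mult_le {p : ℝ≥0∞} (hp : 1 ≤ p) {γ : ℝ → ℝ≥0∞} {K : ℝ≥0∞}
    (hK : AvgBound p γ K) {q : ℤ → ℂ} {n : ℕ} {B : ℝ} (hn : 1 ≤ n) (hq : SymbolBound q n B)
    {f : ℝ → ℂ} (hf : PerInt f) :
    eLpNorm (mult q f) p (weightedMeasure γ) ≤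
      ENNReal.ofReal (48 * B) * K * eLpNorm f p (weightedMeasure γ) := by
  obtain ⟨I, hI⟩ := pow_unbounded_of_one_lt (Real.pi * n) one_lt_two
  have hB := hq.nonneg hn
  set g : ℝ → ℝ≥0∞ := fun t => ‖f t‖ₑ with hg
  have mg : Measurable g := hf.measurable.enorm
  have pg : Function.Periodic g (2 * Real.pi) := fun x => by simp only [hg, hf.periodic x]
  set μ := weightedMeasure γ
  have hgn : eLpNorm g p μ = eLpNorm f p μ := eLpNorm_enorm f
  have hbd : ∀ i, eLpNorm (fun x => ENNReal.ofReal (12 * B * (1 / 2) ^ i) *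
      (avg (-dyadicRadius n i) 0 g x + avg 0 (dyadicRadius n i) g x)) p μ ≤
      ENNReal.ofReal (12 * B * (1 / 2) ^ i) * (2 * K * eLpNorm f p μ) := by
    intro i
    have hρ := dyadicRadius_pos hn i
    have hρ' : dyadicRadius n i ≤ Real.pi := min_le_right _ _
    rw [eLpNorm_const_mul_ennreal (f := fun x => avg (-dyadicRadius n i) 0 g x +
      avg 0 (dyadicRadius n i) g x) _ hp ((measurable_avg mg _ _).add (measurable_avg mg _ _))]
    refine mul_le_mul_right ?_ _
    refine (eLpNorm_add_le (measurable_avg mg _ _).aestronglyMeasurable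
      (measurable_avg mg _ _).aestronglyMeasurable hp).trans ?_
    rw [two_mul, add_mul, ← hgn]
    exact add_le_add (hK g mg pg _ _ (by linarith) le_rfl (by linarith) (by linarith))
      (hK g mg pg _ _ le_rfl hρ.le hρ (by linarith))
  calc eLpNorm (mult q f) p μ ≤ eLpNorm (∑ i ∈ Finset.range (I + 1), fun x =>
        ENNReal.ofReal (12 * B * (1 / 2) ^ i) *
        (avg (-dyadicRadius n i) 0 g x + avg 0 (dyadicRadius n i) g x)) p μ := by
        refine eLpNorm_mono_enorm fun x => ?_
        rw [enorm_eq_self, Finset.sum_apply]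
        exact enorm_mult_le hn hq hf hI x
    _ ≤ ∑ i ∈ Finset.range (I + 1), eLpNorm (fun x => ENNReal.ofReal (12 * B * (1 / 2) ^ i) *
        (avg (-dyadicRadius n i) 0 g x + avg 0 (dyadicRadius n i) g x)) p μ :=
        eLpNorm_sum_le (fun i _ => (((measurable_avg mg _ _).add
          (measurable_avg mg _ _)).const_mul _).aestronglyMeasurable) hp
    _ ≤ ∑ i ∈ Finset.range (I + 1), ENNReal.ofReal (12 * B * (1 / 2) ^ i) *
        (2 * K * eLpNorm f p μ) := Finset.sum_le_sum fun i _ => hbd i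
    _ = ENNReal.ofReal (∑ i ∈ Finset.range (I + 1), 12 * B * (1 / 2) ^ i) *
        (2 * K * eLpNorm f p μ) := by
        rw [ENNReal.ofReal_sum_of_nonneg fun i _ => by positivity, Finset.sum_mul]
    _ ≤ ENNReal.ofReal (24 * B) * (2 * K * eLpNorm f p μ) := by
        gcongr
        rw [← Finset.mul_sum, show 24 * B = 12 * B * 2 by ring]
        gcongr
        have := sum_geometric_two_le (I + 1)
        simpa using this
    _ = _ := by
        rw [show 48 * B = 2 * (24 * B) by ring, ENNReal.ofReal_mul (p := 2) (by norm_num)]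
        simp only [ENNReal.ofReal_ofNat]
        ring

/-! ### Symbols -/

/-- Symbols of order `-k`: twice differentiable functions that are `O((1 + |s|) ^ (-k))` together
with their first two derivatives. -/
def IsSymbol (k : ℕ) (φ : ℝ → ℂ) : Prop :=
  ∃ φ₁ φ₂ : ℝ → ℂ, (∀ s, HasDerivAt φ (φ₁ s) s) ∧ (∀ s, HasDerivAt φ₁ (φ₂ s) s) ∧
    ∃ C : ℝ, 0 ≤ C ∧ ∀ s, ‖φ s‖ ≤ C * ((1 + |s|)⁻¹) ^ k ∧ ‖φ₁ s‖ ≤ C * ((1 + |s|)⁻¹) ^ k ∧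
      ‖φ₂ s‖ ≤ C * ((1 + |s|)⁻¹) ^ k

theorem one_add_abs_pos (s : ℝ) : 0 < 1 + |s| := by positivity

theorem weight_le_one (s : ℝ) : (1 + |s|)⁻¹ ≤ 1 := inv_le_one_of_one_le₀ (by linarith [abs_nonneg s])

theorem IsSymbol.mul {k m : ℕ} {φ ψ : ℝ → ℂ} (hφ : IsSymbol k φ) (hψ : IsSymbol m ψ) :
    IsSymbol (k + m) fun s => φ s * ψ s := by
  obtain ⟨φ₁, φ₂, h1, h2, C, hC, hb⟩ := hφ
  obtain ⟨ψ₁, ψ₂, g1, g2, D, hD, gb⟩ := hψ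
  refine ⟨fun s => φ₁ s * ψ s + φ s * ψ₁ s,
    fun s => (φ₂ s * ψ s + φ₁ s * ψ₁ s) + (φ₁ s * ψ₁ s + φ s * ψ₂ s),
    fun s => (h1 s).mul (g1 s),
    fun s => ((h2 s).mul (g1 s)).add ((h1 s).mul (g2 s)), 4 * C * D, by positivity, fun s => ?_⟩
  obtain ⟨a0, a1, a2⟩ := hb s
  obtain ⟨b0, b1, b2⟩ := gb s
  have hw : 0 ≤ (1 + |s|)⁻¹ := (inv_pos.2 (one_add_abs_pos s)).le
  have key : ∀ {x y : ℂ}, ‖x‖ ≤ C * ((1 + |s|)⁻¹) ^ k → ‖y‖ ≤ D * ((1 + |s|)⁻¹) ^ m →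
      ‖x * y‖ ≤ C * D * ((1 + |s|)⁻¹) ^ (k + m) := by
    intro x y hx hy
    rw [norm_mul]
    calc _ ≤ (C * ((1 + |s|)⁻¹) ^ k) * (D * ((1 + |s|)⁻¹) ^ m) := by gcongr
      _ = _ := by ring
  have hpos : 0 ≤ C * D * ((1 + |s|)⁻¹) ^ (k + m) := by positivity
  refine ⟨(key a0 b0).trans (by linarith), (norm_add_le _ _).trans ?_, (norm_add_le _ _).trans ?_⟩
  · linarith [key a1 b0, key a0 b1]
  · linarith [key a1 b1, key a2 b0, key a0 b2, norm_add_le (φ₂ s * ψ s) (φ₁ s * ψ₁ s),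
      norm_add_le (φ₁ s * ψ₁ s) (φ s * ψ₂ s)]

theorem IsSymbol.zero_order {k : ℕ} {φ : ℝ → ℂ} (h : IsSymbol k φ) : IsSymbol 0 φ := by
  obtain ⟨φ₁, φ₂, h1, h2, C, hC, hb⟩ := h
  refine ⟨φ₁, φ₂, h1, h2, C, hC, fun s => ?_⟩
  have hw : C * ((1 + |s|)⁻¹) ^ k ≤ C * ((1 + |s|)⁻¹) ^ 0 := by
    rw [pow_zero]
    gcongr
    exact pow_le_one₀ (inv_pos.2 (one_add_abs_pos s)).le (weight_le_one s)
  exact ⟨(hb s).1.trans hw, (hb s).2.1.trans hw, (hb s).2.2.trans hw⟩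

theorem IsSymbol.one_sub {φ : ℝ → ℂ} (h : IsSymbol 0 φ) : IsSymbol 0 fun s => 1 - φ s := by
  obtain ⟨φ₁, φ₂, h1, h2, C, hC, hb⟩ := h
  refine ⟨fun s => -φ₁ s, fun s => -φ₂ s, fun s => (h1 s).const_sub 1, fun s => (h2 s).neg,
    1 + C, by positivity, fun s => ?_⟩
  obtain ⟨a0, a1, a2⟩ := hb s
  rw [pow_zero, mul_one] at *
  simp only [norm_neg]
  exact ⟨(norm_sub_le _ _).trans (by simpa using a0), by linarith, by linarith⟩

theorem IsSymbol.inv {φ : ℝ → ℂ} (h : IsSymbol 0 φ) {δ : ℝ} (hδ : 0 < δ)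
    (hφ : ∀ s, δ ≤ ‖φ s‖) : IsSymbol 0 fun s => (φ s)⁻¹ := by
  obtain ⟨φ₁, φ₂, h1, h2, C, hC, hb⟩ := h
  have hne : ∀ s, φ s ≠ 0 := fun s => norm_pos_iff.1 (hδ.trans_le (hφ s))
  have hinv : ∀ s, ‖(φ s)⁻¹‖ ≤ δ⁻¹ := fun s => by
    rw [norm_inv]; exact inv_anti₀ hδ (hφ s)
  have d0 : ∀ s, HasDerivAt (fun s => (φ s)⁻¹) (-(φ₁ s * ((φ s)⁻¹ * (φ s)⁻¹))) s := fun s => by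
    convert! (h1 s).fun_inv (hne s) using 1
    field_simp
  refine ⟨fun s => -(φ₁ s * ((φ s)⁻¹ * (φ s)⁻¹)), _, d0,
    fun s => ((h2 s).mul ((d0 s).mul (d0 s))).neg,
    δ⁻¹ + C * (δ⁻¹ * δ⁻¹) + (C * (δ⁻¹ * δ⁻¹) + C * (C * (δ⁻¹ * δ⁻¹) * δ⁻¹ + δ⁻¹ * (C * (δ⁻¹ * δ⁻¹)))),
    by positivity, fun s => ?_⟩
  obtain ⟨a0, a1, a2⟩ := hb s
  rw [pow_zero, mul_one] at *
  have i0 := hinv s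
  have hd : ‖-(φ₁ s * ((φ s)⁻¹ * (φ s)⁻¹))‖ ≤ C * (δ⁻¹ * δ⁻¹) := by
    rw [norm_neg, norm_mul, norm_mul]; gcongr
  have p0 : 0 ≤ δ⁻¹ := by positivity
  have p1 : 0 ≤ C * (δ⁻¹ * δ⁻¹) := by positivity
  have p2 : 0 ≤ C * (C * (δ⁻¹ * δ⁻¹) * δ⁻¹ + δ⁻¹ * (C * (δ⁻¹ * δ⁻¹))) := by positivity
  refine ⟨by linarith, by linarith, ?_⟩
  rw [norm_neg]
  refine (norm_add_le _ _).trans ?_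
  have e1 : ‖φ₂ s * ((φ s)⁻¹ * (φ s)⁻¹)‖ ≤ C * (δ⁻¹ * δ⁻¹) := by
    rw [norm_mul, norm_mul]; gcongr
  have e2 : ‖φ₁ s * (-(φ₁ s * ((φ s)⁻¹ * (φ s)⁻¹)) * (φ s)⁻¹ +
      (φ s)⁻¹ * -(φ₁ s * ((φ s)⁻¹ * (φ s)⁻¹)))‖ ≤
      C * (C * (δ⁻¹ * δ⁻¹) * δ⁻¹ + δ⁻¹ * (C * (δ⁻¹ * δ⁻¹))) := by
    rw [norm_mul]
    gcongr
    refine (norm_add_le _ _).trans ?_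
    rw [norm_mul, norm_mul]
    gcongr
  refine (add_le_add e1 e2).trans ?_
  linarith

theorem IsSymbol.of_contDiff {k : ℕ} {φ : ℝ → ℂ} (h : ContDiff ℝ 2 φ) {C : ℝ}
    (hC : ∀ s, 2 ≤ |s| → ‖φ s‖ ≤ C * ((1 + |s|)⁻¹) ^ k ∧ ‖deriv φ s‖ ≤ C * ((1 + |s|)⁻¹) ^ k ∧
      ‖deriv (deriv φ) s‖ ≤ C * ((1 + |s|)⁻¹) ^ k) : IsSymbol k φ := by
  have h' : ContDiff ℝ 1 (deriv φ) := by
    have : ContDiff ℝ (1 + 1) φ := by simpa [one_add_one_eq_two] using h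
    exact (contDiff_succ_iff_deriv.1 this).2.2
  have h'' : Continuous (deriv (deriv φ)) := h'.continuous_deriv le_rfl
  have bdd : ∀ ψ : ℝ → ℂ, Continuous ψ → ∃ M : ℝ, 0 ≤ M ∧ ∀ s, |s| ≤ 2 →
      ‖ψ s‖ ≤ M * ((1 + |s|)⁻¹) ^ k := by
    intro ψ hψ
    obtain ⟨M, hM⟩ := (isCompact_Icc (a := (-2 : ℝ)) (b := 2)).exists_bound_of_continuousOn
      hψ.continuousOn
    -- On `|s| ≤ 2` one has `1 + |s| ≤ 3`, so the factor `3^k` absorbs the decay required there.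
    refine ⟨|M| * 3 ^ k, by positivity, fun s hs => ?_⟩
    refine (hM s (abs_le.1 hs)).trans ?_
    rw [mul_assoc, ← mul_pow]
    have : 1 ≤ 3 * (1 + |s|)⁻¹ := by
      rw [← div_eq_mul_inv, le_div_iff₀ (one_add_abs_pos s)]; linarith
    calc M ≤ |M| * 1 := by rw [mul_one]; exact le_abs_self M
      _ ≤ _ := by gcongr; exact one_le_pow₀ this
  obtain ⟨M0, p0, b0⟩ := bdd φ h.continuous
  obtain ⟨M1, p1, b1⟩ := bdd _ h'.continuous
  obtain ⟨M2, p2, b2⟩ := bdd _ h''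
  refine ⟨deriv φ, deriv (deriv φ), fun s => (h.differentiable (by norm_num) s).hasDerivAt,
    fun s => (h'.differentiable (by norm_num) s).hasDerivAt, |C| + M0 + M1 + M2, by positivity,
    fun s => ?_⟩
  have hw : 0 ≤ ((1 + |s|)⁻¹) ^ k := pow_nonneg (inv_pos.2 (one_add_abs_pos s)).le _
  have mono : ∀ {M x : ℝ}, M ≤ |C| + M0 + M1 + M2 → x ≤ M * ((1 + |s|)⁻¹) ^ k →
      x ≤ (|C| + M0 + M1 + M2) * ((1 + |s|)⁻¹) ^ k := fun hM hx =>
    hx.trans (mul_le_mul_of_nonneg_right hM hw)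
  have hCa := le_abs_self C
  have hCn := abs_nonneg C
  rcases le_total |s| 2 with hs | hs
  · exact ⟨mono (by linarith) (b0 s hs), mono (by linarith) (b1 s hs), mono (by linarith) (b2 s hs)⟩
  · obtain ⟨c0, c1, c2⟩ := hC s hs
    exact ⟨mono (by linarith) c0, mono (by linarith) c1, mono (by linarith) c2⟩

theorem IsSymbol.exp_sub_one : IsSymbol 0 fun s : ℝ => Complex.exp (Complex.I * s) - 1 := by
  have d : ∀ s : ℝ, HasDerivAt (fun s : ℝ => Complex.exp (Complex.I * s))
      (Complex.I * Complex.exp (Complex.I * s)) s := fun s => by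
    have h1 : HasDerivAt (fun y : ℝ => Complex.I * (y : ℂ)) (Complex.I * 1) s :=
      (HasDerivAt.ofReal_comp (hasDerivAt_id s)).const_mul Complex.I
    have := h1.cexp
    rwa [mul_one, mul_comm] at this
  have hn : ∀ s : ℝ, ‖Complex.exp (Complex.I * s)‖ = 1 := fun s => by
    rw [mul_comm, Complex.norm_exp_ofReal_mul_I]
  refine ⟨fun s => Complex.I * Complex.exp (Complex.I * s),
    fun s => Complex.I * (Complex.I * Complex.exp (Complex.I * s)),
    fun s => (d s).sub_const 1, fun s => (d s).const_mul _, 2, by norm_num, fun s => ?_⟩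
  refine ⟨(norm_sub_le _ _).trans ?_, ?_, ?_⟩
  · simp [hn]; norm_num
  · simp [hn]
  · simp [hn]

/-! ### Sampling a symbol at the points `j / n`. -/

theorem norm_second_diff_le {φ φ₁ φ₂ : ℝ → ℂ} (h1 : ∀ s, HasDerivAt φ (φ₁ s) s)
    (h2 : ∀ s, HasDerivAt φ₁ (φ₂ s) s) {t h M : ℝ} (hh : 0 ≤ h)
    (hM : ∀ s ∈ Icc t (t + 2 * h), ‖φ₂ s‖ ≤ M) :
    ‖φ (t + 2 * h) - 2 * φ (t + h) + φ t‖ ≤ M * h ^ 2 := by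
  have b1 : ∀ s ∈ Icc t (t + h), ‖φ₁ (s + h) - φ₁ s‖ ≤ M * h := by
    intro s hs
    have := (convex_Icc t (t + 2 * h)).norm_image_sub_le_of_norm_hasDerivWithin_le
      (fun x _ => (h2 x).hasDerivWithinAt) hM (x := s) (y := s + h)
      ⟨hs.1, by linarith [hs.2]⟩ ⟨by linarith [hs.1], by linarith [hs.2]⟩
    simpa [abs_of_nonneg hh] using this
  have d : ∀ s, HasDerivAt (fun s => φ (s + h) - φ s) (φ₁ (s + h) - φ₁ s) s := fun s =>
    ((h1 (s + h)).comp_add_const s h).sub (h1 s)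
  have := (convex_Icc t (t + h)).norm_image_sub_le_of_norm_hasDerivWithin_le
    (fun x _ => (d x).hasDerivWithinAt) b1 (x := t) (y := t + h)
    ⟨le_rfl, by linarith⟩ ⟨by linarith, le_rfl⟩
  rw [add_sub_cancel_left, Real.norm_of_nonneg hh, show t + h + h = t + 2 * h by ring] at this
  calc _ = ‖φ (t + 2 * h) - φ (t + h) - (φ (t + h) - φ t)‖ := by congr 1; ring
    _ ≤ _ := this
    _ = _ := by ring

theorem summable_weight_sq : Summable fun a : ℤ => ((1 + |(a : ℝ)|)⁻¹) ^ 2 := by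
  have h : Summable fun a : ℕ => ((1 + |(a : ℝ)|)⁻¹) ^ 2 := by
    have := (summable_nat_add_iff 1).2 (Real.summable_one_div_nat_pow.2 one_lt_two)
    refine this.congr fun a => ?_
    push_cast
    rw [abs_of_nonneg (Nat.cast_nonneg a), inv_pow, one_div, add_comm]
  exact Summable.of_nat_of_neg (by simpa using h) (by simpa using h)

/-- Write `j = a n + b` with `0 ≤ b < n`. The weight at `j/n` is at most `4` times the weight at
`a`, and each `a` occurs `n` times. -/
theorem exists_sum_weight_le : ∃ S : ℝ, 0 ≤ S ∧ ∀ n : ℕ, 1 ≤ n →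
    (Summable fun j : ℤ => ((1 + |(j / n : ℝ)|)⁻¹) ^ 2) ∧
      ∑' j : ℤ, ((1 + |(j / n : ℝ)|)⁻¹) ^ 2 ≤ S * n := by
  set S : ℝ := ∑' a : ℤ, 4 * ((1 + |(a : ℝ)|)⁻¹) ^ 2 with hS
  have hS0 : 0 ≤ S := tsum_nonneg fun a => by positivity
  refine ⟨S, hS0, fun n hn => ?_⟩
  have : NeZero n := ⟨by omega⟩
  have hn0 : (0 : ℝ) < n := by exact_mod_cast hn
  have hle : ∀ z : ℤ × Fin n, ((1 + |(((Int.divModEquiv n).symm z : ℤ) / n : ℝ)|)⁻¹) ^ 2 ≤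
      4 * ((1 + |(z.1 : ℝ)|)⁻¹) ^ 2 := by
    rintro ⟨a, b⟩
    rw [Int.divModEquiv_symm_apply]
    push_cast
    set s : ℝ := (a * n + b.val) / n with hs
    have hb : (b.val : ℝ) < n := by exact_mod_cast b.2
    have hsa : s = a + b.val / n := by rw [hs]; field_simp
    have hb1 : (b.val : ℝ) / n < 1 := (div_lt_one hn0).2 hb
    have hb0 : 0 ≤ (b.val : ℝ) / n := by positivity
    have : |(a : ℝ)| ≤ |s| + 1 := by
      rw [show (a : ℝ) = s - b.val / n by rw [hsa]; ring]
      refine (abs_sub _ _).trans ?_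
      rw [abs_of_nonneg hb0]; linarith
    have h2 : (1 + |s|)⁻¹ ≤ 2 * (1 + |(a : ℝ)|)⁻¹ := by
      rw [← div_eq_mul_inv, inv_eq_one_div, div_le_div_iff₀ (one_add_abs_pos _) (one_add_abs_pos _)]
      linarith [abs_nonneg s]
    calc ((1 + |s|)⁻¹) ^ 2 ≤ (2 * (1 + |(a : ℝ)|)⁻¹) ^ 2 := by
          gcongr
      _ = _ := by ring
  -- In `[0, ∞]` the sum can be rearranged freely; summability over the reals is then a consequence
  -- of the bound.
  have hE : ∑' j : ℤ, ENNReal.ofReal (((1 + |(j / n : ℝ)|)⁻¹) ^ 2) ≤ ENNReal.ofReal (S * n) := by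
    rw [← (Int.divModEquiv n).symm.tsum_eq]
    calc _ ≤ ∑' z : ℤ × Fin n, ENNReal.ofReal (4 * ((1 + |(z.1 : ℝ)|)⁻¹) ^ 2) :=
          ENNReal.tsum_le_tsum fun z => ENNReal.ofReal_le_ofReal (hle z)
      _ = ∑' a : ℤ, (n : ℝ≥0∞) * ENNReal.ofReal (4 * ((1 + |(a : ℝ)|)⁻¹) ^ 2) := by
          rw [ENNReal.tsum_prod (f := fun (a : ℤ) (_ : Fin n) =>
            ENNReal.ofReal (4 * ((1 + |(a : ℝ)|)⁻¹) ^ 2))]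
          simp
      _ = ENNReal.ofReal (S * n) := by
          rw [ENNReal.tsum_mul_left, ← ENNReal.ofReal_tsum_of_nonneg (fun a => by positivity)
            (summable_weight_sq.mul_left 4), ← hS, mul_comm, ENNReal.ofReal_mul hS0,
            ENNReal.ofReal_natCast]
  have hsum : Summable fun j : ℤ => ((1 + |(j / n : ℝ)|)⁻¹) ^ 2 := by
    have := ENNReal.summable_toReal (hE.trans_lt ENNReal.ofReal_lt_top).ne
    refine this.congr fun j => ENNReal.toReal_ofReal (by positivity)
  refine ⟨hsum, ?_⟩
  rw [← ENNReal.ofReal_tsum_of_nonneg (fun a => by positivity) hsum] at hE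
  exact (ENNReal.ofReal_le_ofReal_iff (by positivity)).1 hE

/-- A second difference with step `1/n` is at most `n⁻²` times the supremum of `φ₂` over an interval
of length `2/n ≤ 2`, on which `(1 + |s|)⁻²` varies by a factor of at most `9`. Summing about `n`
such terms per unit length leaves `1/n`. -/
theorem IsSymbol.exists_symbolBound {φ : ℝ → ℂ} (h : IsSymbol 2 φ) :
    ∃ B : ℝ, ∀ n : ℕ, 1 ≤ n → SymbolBound (fun j : ℤ => φ (j / n)) n B := by
  obtain ⟨φ₁, φ₂, h1, h2, C, hC, hb⟩ := h
  obtain ⟨S, hS, hw⟩ := exists_sum_weight_le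
  refine ⟨9 * C * S, fun n hn => ?_⟩
  obtain ⟨hs, hle⟩ := hw n hn
  have hn0 : (0 : ℝ) < n := by exact_mod_cast hn
  have hs1 : Summable fun j : ℤ => ‖φ (j / n)‖ :=
    Summable.of_nonneg_of_le (fun _ => norm_nonneg _) (fun j => (hb _).1) (hs.mul_left C)
  refine ⟨hs1, ?_, ?_⟩
  · calc _ ≤ ∑' j : ℤ, C * ((1 + |(j / n : ℝ)|)⁻¹) ^ 2 :=
          hs1.tsum_le_tsum (fun j => (hb _).1) (hs.mul_left C)
      _ ≤ C * (S * n) := by rw [tsum_mul_left]; gcongr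
      _ ≤ _ := by nlinarith [mul_nonneg (mul_nonneg hC hS) hn0.le]
  · have hd : ∀ j : ℤ, ‖φ ((j + 2 : ℤ) / n) - 2 * φ ((j + 1 : ℤ) / n) + φ (j / n)‖ ≤
        9 * C / n ^ 2 * ((1 + |(j / n : ℝ)|)⁻¹) ^ 2 := by
      intro j
      have := norm_second_diff_le h1 h2 (t := j / n) (h := 1 / n)
        (M := C * (9 * ((1 + |(j / n : ℝ)|)⁻¹) ^ 2)) (by positivity) (by
          intro s hs
          refine (hb s).2.2.trans ?_
          gcongr
          have hn1 : (1 : ℝ) / n ≤ 1 := by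
            rw [div_le_one hn0]; exact_mod_cast hn
          have : |(j / n : ℝ)| ≤ |s| + 2 := by
            rw [show (j / n : ℝ) = s - (s - j / n) by ring]
            refine (abs_sub _ _).trans ?_
            have : |s - j / n| ≤ 2 := abs_le.2 ⟨by linarith [hs.1], by linarith [hs.2]⟩
            linarith
          have h2 : (1 + |s|)⁻¹ ≤ 3 * (1 + |(j / n : ℝ)|)⁻¹ := by
            rw [← div_eq_mul_inv, inv_eq_one_div,
              div_le_div_iff₀ (one_add_abs_pos _) (one_add_abs_pos _)]
            linarith [abs_nonneg s]
          calc ((1 + |s|)⁻¹) ^ 2 ≤ (3 * (1 + |(j / n : ℝ)|)⁻¹) ^ 2 := by gcongr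
            _ = _ := by ring)
      rw [show ((j + 2 : ℤ) : ℝ) / n = j / n + 2 * (1 / n) by push_cast; ring,
        show ((j + 1 : ℤ) : ℝ) / n = j / n + 1 / n by push_cast; ring]
      exact this.trans_eq (by ring)
    have hs2 := hs.mul_left (9 * C / (n : ℝ) ^ 2)
    calc _ ≤ ∑' j : ℤ, 9 * C / n ^ 2 * ((1 + |(j / n : ℝ)|)⁻¹) ^ 2 :=
          (Summable.of_nonneg_of_le (fun _ => norm_nonneg _) hd hs2).tsum_le_tsum hd hs2
      _ ≤ 9 * C / n ^ 2 * (S * n) := by rw [tsum_mul_left]; gcongr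
      _ = _ := by field_simp

/-! ### The cut-offs and the symbol of the Steklov mean. -/

noncomputable section

/-- A smooth cut-off, equal to `1` on `[-1/2, 1/2]` and to `0` outside `(-1, 1)`. -/
def cutoff (s : ℝ) : ℂ :=
  ((⟨1 / 2, 1, by norm_num, by norm_num⟩ : ContDiffBump (0 : ℝ)) s : ℝ)

/-- The cut-off at half the scale. -/
def cutoff' (s : ℝ) : ℝ := (⟨1 / 4, 1 / 2, by norm_num, by norm_num⟩ : ContDiffBump (0 : ℝ)) s

theorem cutoff_of_le {s : ℝ} (h : |s| ≤ 1 / 2) : cutoff s = 1 := by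
  rw [cutoff, ContDiffBump.one_of_mem_closedBall _ (by simpa [Real.norm_eq_abs] using h),
    Complex.ofReal_one]

theorem cutoff_of_ge {s : ℝ} (h : 1 ≤ |s|) : cutoff s = 0 := by
  rw [cutoff, ContDiffBump.zero_of_le_dist _ (by simpa [Real.norm_eq_abs] using h),
    Complex.ofReal_zero]

theorem cutoff'_of_le {s : ℝ} (h : |s| ≤ 1 / 4) : cutoff' s = 1 :=
  ContDiffBump.one_of_mem_closedBall _ (by simpa [Real.norm_eq_abs] using h)

theorem cutoff'_of_ge {s : ℝ} (h : 1 / 2 ≤ |s|) : cutoff' s = 0 :=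
  ContDiffBump.zero_of_le_dist _ (by simpa [Real.norm_eq_abs] using h)

theorem isSymbol_cutoff (k : ℕ) : IsSymbol k cutoff := by
  have hd : ContDiff ℝ 2 cutoff := Complex.ofRealCLM.contDiff.comp (ContDiffBump.contDiff _)
  have hev : ∀ s : ℝ, 2 ≤ |s| → cutoff =ᶠ[nhds s] fun _ => 0 := by
    intro s hs
    have : ∀ᶠ x in nhds s, 1 < |x| := continuous_abs.continuousAt.eventually_const_lt (by linarith)
    filter_upwards [this] with x hx using cutoff_of_ge hx.le
  refine IsSymbol.of_contDiff hd (C := 0) fun s hs => ?_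
  have h1 := (hev s hs).deriv
  have h2 := h1.deriv
  refine ⟨?_, ?_, ?_⟩
  · rw [(hev s hs).eq_of_nhds]; simp
  · rw [h1.eq_of_nhds]; simp
  · rw [h2.eq_of_nhds]; simp

/-- `1 / (i s)` with the singularity at `0` cut off. -/
def cutInv (s : ℝ) : ℂ := ((1 - cutoff' s : ℝ) : ℂ) * (Complex.I * s)⁻¹

theorem cutInv_of_ge {s : ℝ} (h : 1 / 2 ≤ |s|) : cutInv s = (Complex.I * s)⁻¹ := by
  rw [cutInv, cutoff'_of_ge h]; simp

theorem contDiff_cutInv : ContDiff ℝ 2 cutInv := by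
  rw [contDiff_iff_contDiffAt]
  intro s
  rcases eq_or_ne s 0 with rfl | hs
  · have : cutInv =ᶠ[nhds 0] fun _ => 0 := by
      have : ∀ᶠ x in nhds (0 : ℝ), |x| < 1 / 4 :=
        continuous_abs.continuousAt.eventually_lt_const (by norm_num)
      filter_upwards [this] with x hx
      rw [cutInv, cutoff'_of_le hx.le]; simp
    exact contDiffAt_const.congr_of_eventuallyEq this
  · have h1 : ContDiff ℝ 2 fun s : ℝ => ((1 - cutoff' s : ℝ) : ℂ) :=
      Complex.ofRealCLM.contDiff.comp (contDiff_const.sub (ContDiffBump.contDiff _))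
    have h2 : ContDiff ℝ 2 fun s : ℝ => Complex.I * (s : ℂ) :=
      contDiff_const.mul Complex.ofRealCLM.contDiff
    exact h1.contDiffAt.mul (h2.contDiffAt.inv (by simpa using hs))

theorem isSymbol_cutInv : IsSymbol 1 cutInv := by
  have hev : ∀ s : ℝ, 2 ≤ |s| → cutInv =ᶠ[nhds s] fun s => (Complex.I * s)⁻¹ := by
    intro s hs
    have : ∀ᶠ x in nhds s, 1 < |x| := continuous_abs.continuousAt.eventually_const_lt (by linarith)
    filter_upwards [this] with x hx using cutInv_of_ge (by linarith)
  have hdl : ∀ s : ℝ, HasDerivAt (fun s : ℝ => Complex.I * (s : ℂ)) Complex.I s := fun s => by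
    simpa using (HasDerivAt.ofReal_comp (hasDerivAt_id s)).const_mul Complex.I
  have hd1 : ∀ s : ℝ, s ≠ 0 → HasDerivAt (fun s : ℝ => (Complex.I * (s : ℂ))⁻¹)
      (-Complex.I * ((Complex.I * (s : ℂ))⁻¹ * (Complex.I * (s : ℂ))⁻¹)) s := fun s hs => by
    have hne : Complex.I * (s : ℂ) ≠ 0 := by simpa using hs
    convert! (hdl s).fun_inv hne using 1
    field_simp
  have hd2 : ∀ s : ℝ, s ≠ 0 → HasDerivAt
      (fun s : ℝ => -Complex.I * ((Complex.I * (s : ℂ))⁻¹ * (Complex.I * (s : ℂ))⁻¹)) _ s :=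
    fun s hs => ((hd1 s hs).mul (hd1 s hs)).const_mul (-Complex.I)
  have hne : ∀ s : ℝ, 2 ≤ |s| → s ≠ 0 := fun s hs h => by rw [h, abs_zero] at hs; linarith
  -- For `|s| ≥ 2` the function and its derivatives have moduli `|s|⁻¹`, `|s|⁻²` and `2|s|⁻³`, all
  -- at most `|s|⁻¹ ≤ 2 (1 + |s|)⁻¹`.
  refine IsSymbol.of_contDiff contDiff_cutInv (C := 2) fun s hs => ?_
  have h1 : deriv cutInv =ᶠ[nhds s]
      fun s : ℝ => -Complex.I * ((Complex.I * (s : ℂ))⁻¹ * (Complex.I * (s : ℂ))⁻¹) := by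
    refine (hev s hs).deriv.trans ?_
    filter_upwards [isOpen_ne.mem_nhds (hne s hs)] with x hx using (hd1 x hx).deriv
  have e2 : deriv (deriv cutInv) s = _ := h1.deriv_eq.trans (hd2 s (hne s hs)).deriv
  rw [(hev s hs).eq_of_nhds, h1.eq_of_nhds, e2]
  have hn : ‖(Complex.I * (s : ℂ))⁻¹‖ = |s|⁻¹ := by simp
  have hpos : 0 < |s| := by linarith
  have hi : |s|⁻¹ ≤ 2 * (1 + |s|)⁻¹ := by
    rw [← div_eq_mul_inv, inv_eq_one_div, div_le_div_iff₀ hpos (one_add_abs_pos _)]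
    linarith
  have hhalf : |s|⁻¹ ≤ 1 / 2 := by
    rw [inv_eq_one_div]; exact one_div_le_one_div_of_le (by norm_num) hs
  have hi0 : 0 ≤ |s|⁻¹ := by positivity
  rw [pow_one]
  refine ⟨by rw [hn]; exact hi, ?_, ?_⟩
  · rw [norm_mul, norm_mul, hn, norm_neg, Complex.norm_I]
    nlinarith
  · rw [norm_mul, norm_neg, Complex.norm_I, one_mul]
    refine (norm_add_le _ _).trans ?_
    simp only [norm_mul, hn, norm_neg, Complex.norm_I, one_mul]
    have : |s|⁻¹ * |s|⁻¹ ≤ 1 / 2 * (1 / 2) := by gcongr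
    nlinarith

/-- The symbol of the Steklov mean at unit scale, cut off near `0`. -/
def tau (s : ℝ) : ℂ := (Complex.exp (Complex.I * s) - 1) * cutInv s

theorem isSymbol_tau : IsSymbol 1 tau := by
  have := IsSymbol.exp_sub_one.mul isSymbol_cutInv
  rwa [zero_add] at this

theorem norm_tau (s : ℝ) : ‖tau s‖ = 2 * |Real.sin (s / 2)| * (|1 - cutoff' s| * |s|⁻¹) := by
  rw [tau, cutInv, norm_mul, Complex.norm_exp_I_mul_ofReal_sub_one, norm_mul (_ : ℂ),
    Complex.norm_real]
  simp

/-- This is the strict inequality `|sin(s/2)| < |s|/2`; at `s = 0` the inner cut-off makes `tau`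
vanish. -/
theorem norm_tau_lt_one (s : ℝ) : ‖tau s‖ < 1 := by
  rw [norm_tau]
  rcases eq_or_ne s 0 with rfl | hs
  · simp
  have hpos : 0 < |s| := abs_pos.2 hs
  have h1 : |1 - cutoff' s| ≤ 1 := by
    have h0 : 0 ≤ cutoff' s := ContDiffBump.nonneg _
    have h1 : cutoff' s ≤ 1 := ContDiffBump.le_one _
    exact abs_le.2 ⟨by linarith, by linarith⟩
  have h2 : |Real.sin (s / 2)| < |s| / 2 := by
    have := Real.abs_sin_lt_abs (x := s / 2) (by simpa using hs)
    rwa [abs_div, abs_two] at this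
  calc _ ≤ 2 * |Real.sin (s / 2)| * (1 * |s|⁻¹) := by gcongr
    _ < 2 * (|s| / 2) * (1 * |s|⁻¹) := by gcongr
    _ = 1 := by field_simp

/-- `1 - tau` has no zero, so it has a positive minimum on a compact interval; outside it `tau` has
decayed below `1/2`. -/
theorem exists_le_norm_one_sub_tau : ∃ δ : ℝ, 0 < δ ∧ ∀ s, δ ≤ ‖1 - tau s‖ := by
  obtain ⟨C, hC⟩ : ∃ C : ℝ, ∀ s, ‖tau s‖ ≤ C * (1 + |s|)⁻¹ := by
    obtain ⟨_, _, _, _, C, _, hb⟩ := isSymbol_tau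
    exact ⟨C, fun s => by simpa using (hb s).1⟩
  have hcont : Continuous tau := by
    obtain ⟨_, _, h, _⟩ := isSymbol_tau
    exact continuous_iff_continuousAt.2 fun s => (h s).continuousAt
  have hpos : ∀ s, 0 < ‖1 - tau s‖ := fun s => by
    have := norm_sub_norm_le (1 : ℂ) (tau s)
    rw [norm_one] at this
    linarith [norm_tau_lt_one s]
  set R := 2 * |C| + 1
  obtain ⟨x, -, hx⟩ := (isCompact_Icc (a := -R) (b := R)).exists_isMinOn
    ⟨0, abs_le.1 (by rw [abs_zero]; positivity)⟩
    (continuous_const.sub hcont).norm.continuousOn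
  refine ⟨min ‖1 - tau x‖ (1 / 2), lt_min (hpos x) (by norm_num), fun s => ?_⟩
  rcases le_or_gt |s| R with h | h
  · exact (min_le_left _ _).trans (hx (abs_le.1 h))
  · refine (min_le_right _ _).trans ?_
    have h1 : ‖tau s‖ ≤ 1 / 2 := by
      refine (hC s).trans ?_
      rw [← div_eq_mul_inv, div_le_iff₀ (one_add_abs_pos s)]
      linarith [le_abs_self C]
    have := norm_sub_norm_le (1 : ℂ) (tau s)
    rw [norm_one] at this
    linarith

/-- The symbol `(1 - η) τ² / (1 - τ)`. -/
def stekInvSymbol (s : ℝ) : ℂ := (1 - cutoff s) * (tau s * tau s) * (1 - tau s)⁻¹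

/-- The square of `tau` supplies the order `-2` needed for summability; a single factor `tau` would
give order `-1` only. -/
theorem isSymbol_stekInvSymbol : IsSymbol 2 stekInvSymbol := by
  obtain ⟨δ, hδ, h⟩ := exists_le_norm_one_sub_tau
  have := (((isSymbol_cutoff 0).one_sub).mul (isSymbol_tau.mul isSymbol_tau)).mul
    (isSymbol_tau.zero_order.one_sub.inv hδ h)
  exact this

/-- `cutoff'` vanishes for `|s| ≥ 1/2`, while `cutoff` is `1` for `|s| ≤ 1/2`: the truncation inside
`tau` is invisible wherever `1 - cutoff` is not zero. -/
theorem stekSymbol_eq_tau {n : ℕ} {j : ℤ} (hj : 1 / 2 ≤ |(j / n : ℝ)|) :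
    stekSymbol (1 / n) j = tau (j / n) := by
  have hj0 : j ≠ 0 := by
    rintro rfl
    simp at hj
    norm_num at hj
  rw [stekSymbol_of_ne_zero hj0, tau, cutInv_of_ge hj, echar, div_eq_mul_inv, mul_one_div]

theorem stekInvSymbol_mul (n : ℕ) (j : ℤ) :
    stekInvSymbol (j / n) * (1 - stekSymbol (1 / n) j) =
      (1 - cutoff (j / n)) * (stekSymbol (1 / n) j * stekSymbol (1 / n) j) := by
  rcases le_or_gt |(j / n : ℝ)| (1 / 2) with h | h
  · rw [stekInvSymbol, cutoff_of_le h]; simp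
  · rw [stekSymbol_eq_tau h.le, stekInvSymbol]
    have : 1 - tau (j / n) ≠ 0 := by
      intro h0
      have h1 := norm_tau_lt_one (j / n)
      rw [← sub_eq_zero.1 h0, norm_one] at h1
      exact lt_irrefl _ h1
    field_simp

end

noncomputable section

/-! ### The high-pass operator and its estimate by `I - T` -/

/-- Removal of the low frequencies, at scale `n`. -/
def highPass (n : ℕ) (f : ℝ → ℂ) : ℝ → ℂ := f - mult (fun j => cutoff (j / n)) f

/-- The operator `I - T_v`. -/
def stekDiff (v : ℝ) (f : ℝ → ℂ) : ℝ → ℂ := f - cstek v f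

theorem mult_sub {q : ℤ → ℂ} (hq : Summable fun j => ‖q j‖) {f g : ℝ → ℂ} (hf : PerInt f)
    (hg : PerInt g) : mult q (f - g) = mult q f - mult q g := by
  have hs : ∀ (h : ℝ → ℂ) (x : ℝ), Summable fun j => q j * coef h j * echar j x := fun h x =>
    Summable.of_norm (by simpa using summable_mult_term hq h)
  ext x
  rw [Pi.sub_apply, mult, mult, mult, ← (hs f x).tsum_sub (hs g x)]
  congr 1; ext j
  rw [coef_sub hf hg]; ring

theorem cstek_sub {f g : ℝ → ℂ} (hf : PerInt f) (hg : PerInt g) (v : ℝ) :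
    cstek v (f - g) = cstek v f - cstek v g := by
  ext x
  rw [Pi.sub_apply, cstek, cstek, cstek, ← mul_sub,
    ← intervalIntegral.integral_sub (hf.integrable _ _) (hg.integrable _ _)]
  rfl

theorem SymbolBound.mono {q : ℤ → ℂ} {n : ℕ} {B B' : ℝ} (h : SymbolBound q n B) (hB : B ≤ B') :
    SymbolBound q n B' :=
  ⟨h.summable, h.sum_le.trans (by gcongr), h.sum_diff_le.trans (by gcongr)⟩

theorem exists_symbolBound_highPass : ∃ B : ℝ, ∀ n : ℕ, 1 ≤ n →
    SymbolBound (fun j : ℤ => cutoff (j / n)) n B ∧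
    SymbolBound (fun j : ℤ => stekInvSymbol (j / n)) n B := by
  obtain ⟨B₁, h₁⟩ := (isSymbol_cutoff 2).exists_symbolBound
  obtain ⟨B₂, h₂⟩ := isSymbol_stekInvSymbol.exists_symbolBound
  exact ⟨max B₁ B₂, fun n hn => ⟨(h₁ n hn).mono (le_max_left _ _), (h₂ n hn).mono (le_max_right _ _)⟩⟩

theorem summable_cutoff {n : ℕ} (hn : 1 ≤ n) : Summable fun j : ℤ => ‖cutoff (j / n)‖ := by
  obtain ⟨B, hB⟩ := exists_symbolBound_highPass
  exact (hB n hn).1.summable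

theorem PerInt.highPass {n : ℕ} (hn : 1 ≤ n) {f : ℝ → ℂ} (hf : PerInt f) :
    PerInt (highPass n f) := hf.sub (PerInt.mult (summable_cutoff hn) f)

theorem PerInt.stekDiff {f : ℝ → ℂ} (hf : PerInt f) (v : ℝ) : PerInt (stekDiff v f) :=
  hf.sub (hf.cstek v)

theorem mult_cstek_comm {q : ℤ → ℂ} (hq : Summable fun j => ‖q j‖) {f : ℝ → ℂ} (hf : PerInt f)
    {v : ℝ} (hv : 0 < v) : cstek v (mult q f) = mult q (cstek v f) := by
  have hm := PerInt.mult hq f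
  have hm' := PerInt.mult hq (cstek v f)
  refine eq_of_coef_eq (continuous_cstek hm v) (continuous_mult hq _) (hm.cstek v).periodic
    hm'.periodic ?_ fun j => ?_
  · simp only [coef_mult hq]
    exact summable_mult_term hq _
  · rw [coef_cstek hm hv, coef_mult hq, coef_mult hq, coef_cstek hf hv]; ring

theorem stekDiff_highPass_comm {n : ℕ} (hn : 1 ≤ n) {f : ℝ → ℂ} (hf : PerInt f) {v : ℝ}
    (hv : 0 < v) : stekDiff v (highPass n f) = highPass n (stekDiff v f) := by
  have hq := summable_cutoff hn
  have hm := PerInt.mult hq f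
  rw [stekDiff, highPass, cstek_sub hf hm, mult_cstek_comm hq hf hv, highPass, stekDiff,
    mult_sub hq hf (hf.cstek v)]
  abel

theorem enorm_cstek_le {f : ℝ → ℂ} {v : ℝ} (hv : 0 < v) (x : ℝ) :
    ‖cstek v f x‖ₑ ≤ avg 0 v (fun t => ‖f t‖ₑ) x := by
  rw [cstek_eq, avg, sub_zero, enorm_mul, intervalIntegral.integral_of_le hv.le]
  gcongr
  · rw [← ENNReal.ofReal_inv_of_pos hv, ← ofReal_norm]
    refine ENNReal.ofReal_le_ofReal ?_
    simp [abs_of_pos hv]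
  · exact enorm_integral_le_lintegral_enorm _

theorem eLpNorm_avg_enorm_le {p : ℝ≥0∞} {γ : ℝ → ℝ≥0∞} {K : ℝ≥0∞} (hK : AvgBound p γ K)
    {f : ℝ → ℂ} (hf : PerInt f) {v : ℝ} (hv : 0 < v) (hv' : v ≤ 1) :
    eLpNorm (avg 0 v fun t => ‖f t‖ₑ) p (weightedMeasure γ) ≤
      K * eLpNorm f p (weightedMeasure γ) := by
  rw [← eLpNorm_enorm f]
  exact hK _ hf.measurable.enorm (fun x => by simp only [hf.periodic x]) 0 v le_rfl hv.le hv
    (by linarith [Real.pi_gt_three])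

theorem eLpNorm_cstek_le {p : ℝ≥0∞} {γ : ℝ → ℝ≥0∞} {K : ℝ≥0∞} (hK : AvgBound p γ K)
    {f : ℝ → ℂ} (hf : PerInt f) {v : ℝ} (hv : 0 < v) (hv' : v ≤ 1) :
    eLpNorm (cstek v f) p (weightedMeasure γ) ≤ K * eLpNorm f p (weightedMeasure γ) :=
  (eLpNorm_mono_enorm fun x => by rw [enorm_eq_self]; exact enorm_cstek_le hv x).trans
    (eLpNorm_avg_enorm_le hK hf hv hv')

/-- With `h = (I - T) f`, the identity `I = (I + T)(I - T) + T²` splits off the first term; in the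
rest, `H T²` is `I - T` followed by the multiplier `(1 - η) τ² / (1 - τ)`. Dividing `H` itself by `I
- T` would leave a symbol that does not decay. -/
theorem highPass_eq {n : ℕ} (hn : 1 ≤ n) {f : ℝ → ℂ} (hf : PerInt f) :
    highPass n f = highPass n (stekDiff (1 / n) f + cstek (1 / n) (stekDiff (1 / n) f)) +
      mult (fun j => stekInvSymbol (j / n)) (stekDiff (1 / n) f) := by
  have hv : (0 : ℝ) < 1 / n := by positivity
  obtain ⟨B, hB⟩ := exists_symbolBound_highPass
  have hq := summable_cutoff hn
  have hQ := (hB n hn).2.summable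
  have hT := hf.cstek (1 / n)
  have hTT := hT.cstek (1 / n)
  have hh := hf.stekDiff (1 / n)
  have hU := PerInt.mult hq (cstek (1 / n) (cstek (1 / n) f))
  have e1 : stekDiff (1 / n) f + cstek (1 / n) (stekDiff (1 / n) f) =
      f - cstek (1 / n) (cstek (1 / n) f) := by
    rw [stekDiff, cstek_sub hf hT]; abel
  have e2 : cstek (1 / n) (cstek (1 / n) f) -
      mult (fun j => cutoff (j / n)) (cstek (1 / n) (cstek (1 / n) f)) =
      mult (fun j => stekInvSymbol (j / n)) (stekDiff (1 / n) f) := by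
    refine eq_of_coef_eq ((continuous_cstek hT _).sub (continuous_mult hq _))
      (continuous_mult hQ _) (hTT.sub hU).periodic (PerInt.mult hQ _).periodic ?_ fun j => ?_
    · simp only [coef_mult hQ]
      exact summable_mult_term hQ _
    · rw [coef_sub hTT hU, coef_mult hq, coef_mult hQ, stekDiff, coef_sub hf hT,
        coef_cstek hT hv, coef_cstek hf hv]
      linear_combination (-coef f j) * stekInvSymbol_mul n j
  rw [e1, ← e2, highPass, highPass, mult_sub hq hf hTT]
  abel

/-- The constant in the estimate of the high-pass operator by `I - T`. -/
def highPassConst (B : ℝ) (K : ℝ≥0∞) : ℝ≥0∞ :=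
  (1 + ENNReal.ofReal (48 * B) * K) * (1 + K) + ENNReal.ofReal (48 * B) * K

theorem PerInt.aestronglyMeasurable {f : ℝ → ℂ} (hf : PerInt f) (μ : Measure ℝ) :
    AEStronglyMeasurable f μ := hf.measurable.aestronglyMeasurable

theorem eLpNorm_sub_mult_le {p : ℝ≥0∞} (hp : 1 ≤ p) {γ : ℝ → ℝ≥0∞} {K : ℝ≥0∞}
    (hK : AvgBound p γ K) {q : ℤ → ℂ} {n : ℕ} {B : ℝ} (hn : 1 ≤ n) (hq : SymbolBound q n B)
    {f : ℝ → ℂ} (hf : PerInt f) :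
    eLpNorm (f - mult q f) p (weightedMeasure γ) ≤
      (1 + ENNReal.ofReal (48 * B) * K) * eLpNorm f p (weightedMeasure γ) := by
  refine (eLpNorm_sub_le (hf.aestronglyMeasurable _)
    ((PerInt.mult hq.summable f).aestronglyMeasurable _) hp).trans ?_
  rw [add_mul, one_mul]
  gcongr
  exact eLpNorm_mult_le hp hK hn hq hf

theorem eLpNorm_highPass_le {p : ℝ≥0∞} (hp : 1 ≤ p) {γ : ℝ → ℝ≥0∞} {K : ℝ≥0∞}
    (hK : AvgBound p γ K) {n : ℕ} {B : ℝ} (hn : 1 ≤ n)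
    (h₁ : SymbolBound (fun j : ℤ => cutoff (j / n)) n B)
    (h₂ : SymbolBound (fun j : ℤ => stekInvSymbol (j / n)) n B) {f : ℝ → ℂ} (hf : PerInt f) :
    eLpNorm (highPass n f) p (weightedMeasure γ) ≤
      highPassConst B K * eLpNorm (stekDiff (1 / n) f) p (weightedMeasure γ) := by
  have hn0 : (0 : ℝ) < n := by exact_mod_cast hn
  have hv : (0 : ℝ) < 1 / n := by positivity
  have hv' : (1 : ℝ) / n ≤ 1 := by rw [div_le_one hn0]; exact_mod_cast hn
  have hh := hf.stekDiff (1 / n)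
  have hT := hh.cstek (1 / n)
  rw [highPass_eq hn hf]
  refine (eLpNorm_add_le (((hh.add hT).highPass hn).aestronglyMeasurable _)
    ((PerInt.mult h₂.summable _).aestronglyMeasurable _) hp).trans ?_
  rw [highPassConst, add_mul, mul_assoc]
  gcongr
  · refine (eLpNorm_sub_mult_le hp hK hn h₁ (hh.add hT)).trans ?_
    gcongr
    refine (eLpNorm_add_le (hh.aestronglyMeasurable _) (hT.aestronglyMeasurable _) hp).trans ?_
    rw [add_mul, one_mul]
    gcongr
    exact eLpNorm_cstek_le hK hh hv hv'
  · exact eLpNorm_mult_le hp hK hn h₂ hh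

theorem PerInt.highPass_iterate {n : ℕ} (hn : 1 ≤ n) {f : ℝ → ℂ} (hf : PerInt f) (m : ℕ) :
    PerInt ((TrigApprox.highPass n)^[m] f) := by
  induction m with
  | zero => exact hf
  | succ m ih => rw [Function.iterate_succ_apply']; exact ih.highPass hn

theorem stekDiff_highPass_iterate_comm {n : ℕ} (hn : 1 ≤ n) {f : ℝ → ℂ} (hf : PerInt f) {v : ℝ}
    (hv : 0 < v) (m : ℕ) : stekDiff v ((highPass n)^[m] f) = (highPass n)^[m] (stekDiff v f) := by
  induction m with
  | zero => rfl
  | succ m ih =>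
    rw [Function.iterate_succ_apply', Function.iterate_succ_apply',
      stekDiff_highPass_comm hn (hf.highPass_iterate hn m) hv, ih]

theorem eLpNorm_highPass_iterate_le {p : ℝ≥0∞} (hp : 1 ≤ p) {γ : ℝ → ℝ≥0∞} {K : ℝ≥0∞}
    (hK : AvgBound p γ K) {n : ℕ} {B : ℝ} (hn : 1 ≤ n)
    (h₁ : SymbolBound (fun j : ℤ => cutoff (j / n)) n B)
    (h₂ : SymbolBound (fun j : ℤ => stekInvSymbol (j / n)) n B) (l : ℕ) {f : ℝ → ℂ}
    (hf : PerInt f) :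
    eLpNorm ((highPass n)^[l] f) p (weightedMeasure γ) ≤
      highPassConst B K ^ l * eLpNorm ((stekDiff (1 / n))^[l] f) p (weightedMeasure γ) := by
  have hv : (0 : ℝ) < 1 / n := by positivity
  induction l generalizing f with
  | zero => simp
  | succ l ih =>
    rw [Function.iterate_succ_apply']
    refine (eLpNorm_highPass_le hp hK hn h₁ h₂ (hf.highPass_iterate hn l)).trans ?_
    rw [stekDiff_highPass_iterate_comm hn hf hv, pow_succ', mul_assoc,
      Function.iterate_succ_apply]
    gcongr
    exact ih (hf.stekDiff _)

end

noncomputable section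

/-! ### Primitives -/

/-- `F` is a periodic primitive of `G`. -/
structure IsPrim (F G : ℝ → ℂ) : Prop where
  left : PerInt F
  right : PerInt G
  sub_eq : ∀ a b : ℝ, F b - F a = ∫ t in a..b, G t

theorem echar_pi_div {j : ℤ} (hj : j ≠ 0) : echar j (Real.pi / |(j : ℝ)|) = -1 := by
  rw [echar]
  have hj' : (j : ℝ) ≠ 0 := by exact_mod_cast hj
  rcases lt_or_gt_of_ne hj' with h | h
  · rw [abs_of_neg h, show (j : ℝ) * (Real.pi / -j) = -Real.pi by field_simp, mul_comm]
    push_cast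
    rw [neg_mul, Complex.exp_neg, Complex.exp_pi_mul_I]
    norm_num
  · rw [abs_of_pos h, show (j : ℝ) * (Real.pi / j) = Real.pi by field_simp, mul_comm,
      Complex.exp_pi_mul_I]

theorem coef_const_mul (c : ℂ) (f : ℝ → ℂ) (j : ℤ) :
    coef (fun x => c * f x) j = c * coef f j := by
  rw [coef, coef]
  simp only [mul_left_comm _ c]
  rw [intervalIntegral.integral_const_mul, mul_left_comm]

/-- Instead of integrating by parts, compare two expressions for the coefficients of the Steklov
mean of `G`, which is a difference quotient of `F`. With `v = π/|j|` one has `e^{ijv} - 1 = -2`, a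
common factor that can be cancelled. -/
theorem coef_eq_of_isPrim {F G : ℝ → ℂ} (h : IsPrim F G) (j : ℤ) :
    coef G j = Complex.I * j * coef F j := by
  rcases eq_or_ne j 0 with rfl | hj
  · rw [coef]
    simp only [neg_zero, echar_zero, one_mul]
    have := h.left.periodic (-Real.pi)
    rw [show -Real.pi + 2 * Real.pi = Real.pi by ring] at this
    rw [← h.sub_eq, this]
    simp
  · have hj' : (j : ℝ) ≠ 0 := by exact_mod_cast hj
    set v := Real.pi / |(j : ℝ)| with hv
    have hv0 : 0 < v := div_pos Real.pi_pos (abs_pos.2 hj')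
    have hvc : (v : ℂ) ≠ 0 := by exact_mod_cast hv0.ne'
    have hjc : (j : ℂ) ≠ 0 := by exact_mod_cast hj
    have e1 : coef (cstek v G) j = stekSymbol v j * coef G j := coef_cstek h.right hv0 j
    have e2 : coef (cstek v G) j = (1 / v : ℂ) * (echar j v * coef F j - coef F j) := by
      have hs : PerInt fun t => F (t + v) := h.left.comp_add v
      have : cstek v G = fun x => (1 / v : ℂ) * ((fun t => F (t + v)) - F) x := by
        ext x
        rw [cstek, ← h.sub_eq]; rfl
      rw [this, coef_const_mul, coef_sub hs h.left, coef_comp_add h.left]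
    rw [stekSymbol_of_ne_zero hj, e2, echar_pi_div hj] at e1
    push_cast at e1
    have hI := Complex.I_ne_zero
    field_simp at e1
    linear_combination -e1

theorem hasDerivAt_mult {q : ℤ → ℂ} {s : Finset ℤ} (hq : ∀ j ∉ s, q j = 0) {F G : ℝ → ℂ}
    (h : IsPrim F G) (x : ℝ) : HasDerivAt (mult q F) (mult q G x) x := by
  have e : ∀ (f : ℝ → ℂ) (x : ℝ), mult q f x = ∑ j ∈ s, q j * coef f j * echar j x :=
    fun f x => tsum_eq_sum fun j hj => by rw [hq j hj]; ring
  rw [show mult q F = fun x => ∑ j ∈ s, q j * coef F j * echar j x from funext (e F), e G]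
  refine HasDerivAt.fun_sum fun j _ => ?_
  rw [coef_eq_of_isPrim h]
  convert! (hasDerivAt_echar j x).const_mul (q j * coef F j) using 1
  ring

theorem IsPrim.sub {F G F' G' : ℝ → ℂ} (h : IsPrim F G) (h' : IsPrim F' G') :
    IsPrim (F - F') (G - G') :=
  ⟨h.left.sub h'.left, h.right.sub h'.right, fun a b => by
    simp only [Pi.sub_apply]
    rw [intervalIntegral.integral_sub (h.right.integrable _ _) (h'.right.integrable _ _),
      ← h.sub_eq, ← h'.sub_eq]
    ring⟩

theorem IsPrim.mult {q : ℤ → ℂ} (hs : Summable fun j => ‖q j‖) {s : Finset ℤ}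
    (hq : ∀ j ∉ s, q j = 0) {F G : ℝ → ℂ} (h : IsPrim F G) : IsPrim (mult q F) (mult q G) :=
  ⟨PerInt.mult hs F, PerInt.mult hs G, fun a b =>
    (intervalIntegral.integral_eq_sub_of_hasDerivAt (fun x _ => hasDerivAt_mult hq h x)
      ((PerInt.mult hs G).integrable a b)).symm⟩

theorem abs_lt_of_cutoff_ne_zero {n : ℕ} (hn : 1 ≤ n) {j : ℤ} (h : cutoff (j / n) ≠ 0) :
    |j| < n := by
  have hn0 : (0 : ℝ) < n := by exact_mod_cast hn
  by_contra hlt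
  refine h (cutoff_of_ge ?_)
  rw [abs_div, Nat.abs_cast, le_div_iff₀ hn0, one_mul]
  have := not_lt.1 hlt
  exact_mod_cast this

theorem IsPrim.highPass {n : ℕ} (hn : 1 ≤ n) {F G : ℝ → ℂ} (h : IsPrim F G) :
    IsPrim (highPass n F) (highPass n G) := by
  refine h.sub (h.mult (summable_cutoff hn) (s := Finset.Icc (-(n : ℤ)) n) fun j hj => ?_)
  by_contra h0
  have := abs_lt.1 (abs_lt_of_cutoff_ne_zero hn h0)
  exact hj (Finset.mem_Icc.2 ⟨this.1.le, this.2.le⟩)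

theorem IsPrim.highPass_iterate {n : ℕ} (hn : 1 ≤ n) {F G : ℝ → ℂ} (h : IsPrim F G) (m : ℕ) :
    IsPrim ((TrigApprox.highPass n)^[m] F) ((TrigApprox.highPass n)^[m] G) := by
  induction m with
  | zero => exact h
  | succ m ih =>
    rw [Function.iterate_succ_apply', Function.iterate_succ_apply']
    exact ih.highPass hn

/-- `(I - T_v) F (x)` is the mean over `0 < u ≤ v` of `F x - F (x + u)`, and each of these
differences is at most the integral of `|G|` over `(x, x + v]`. -/
theorem enorm_stekDiff_le {F G : ℝ → ℂ} (h : IsPrim F G) {v : ℝ} (hv : 0 < v) (x : ℝ) :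
    ‖stekDiff v F x‖ₑ ≤ ENNReal.ofReal v * avg 0 v (fun t => ‖G t‖ₑ) x := by
  have hI : ∫⁻ u in Ioc 0 v, ‖G (x + u)‖ₑ =
      ENNReal.ofReal v * avg 0 v (fun t => ‖G t‖ₑ) x := by
    rw [avg, sub_zero, ← mul_assoc,
      ENNReal.mul_inv_cancel (by simpa using hv) ENNReal.ofReal_ne_top, one_mul]
  rw [← hI]
  have hvc : (v : ℂ) ≠ 0 := by exact_mod_cast hv.ne'
  have hd : ∀ u ∈ Ioc 0 v, ‖F x - F (x + u)‖ₑ ≤ ∫⁻ u in Ioc 0 v, ‖G (x + u)‖ₑ := by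
    intro u hu
    rw [← enorm_neg, neg_sub, h.sub_eq, intervalIntegral.integral_of_le (by linarith [hu.1]),
      setLIntegral_Ioc_comp_add (fun t => ‖G t‖ₑ), add_zero]
    refine (enorm_integral_le_lintegral_enorm _).trans (lintegral_mono_set ?_)
    exact Ioc_subset_Ioc_right (by linarith [hu.2])
  have e : stekDiff v F x = (1 / v : ℂ) * ∫ u in (0 : ℝ)..v, (F x - F (x + u)) := by
    have hint : IntervalIntegrable (fun u => F (x + u)) volume 0 v := by
      simpa [add_comm] using (h.left.comp_add x).integrable 0 v
    rw [intervalIntegral.integral_sub intervalIntegrable_const hint, mul_sub, stekDiff,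
      Pi.sub_apply, cstek_eq]
    congr 1
    rw [intervalIntegral.integral_const, sub_zero, Complex.real_smul]
    field_simp
  rw [e, enorm_mul, intervalIntegral.integral_of_le hv.le]
  have hc : ‖(1 / v : ℂ)‖ₑ = (ENNReal.ofReal v)⁻¹ := by
    rw [← ENNReal.ofReal_inv_of_pos hv, ← ofReal_norm]
    simp [abs_of_pos hv]
  rw [hc]
  calc _ ≤ (ENNReal.ofReal v)⁻¹ * ∫⁻ u in Ioc 0 v, ‖F x - F (x + u)‖ₑ := by
        gcongr
        exact enorm_integral_le_lintegral_enorm _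
    _ ≤ (ENNReal.ofReal v)⁻¹ * ∫⁻ _ in Ioc 0 v, ∫⁻ u in Ioc 0 v, ‖G (x + u)‖ₑ := by
        gcongr 1
        exact setLIntegral_mono' measurableSet_Ioc hd
    _ = _ := by
        rw [setLIntegral_const, Real.volume_Ioc, sub_zero, mul_comm, mul_assoc,
          ENNReal.mul_inv_cancel (by simpa using hv) ENNReal.ofReal_ne_top, mul_one]

theorem eLpNorm_stekDiff_le {p : ℝ≥0∞} (hp : 1 ≤ p) {γ : ℝ → ℝ≥0∞} {K : ℝ≥0∞}
    (hK : AvgBound p γ K) {F G : ℝ → ℂ} (h : IsPrim F G) {v : ℝ} (hv : 0 < v) (hv' : v ≤ 1) :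
    eLpNorm (stekDiff v F) p (weightedMeasure γ) ≤
      ENNReal.ofReal v * (K * eLpNorm G p (weightedMeasure γ)) := by
  calc _ ≤ eLpNorm (fun x => ENNReal.ofReal v * avg 0 v (fun t => ‖G t‖ₑ) x) p
        (weightedMeasure γ) :=
        eLpNorm_mono_enorm fun x => by rw [enorm_eq_self]; exact enorm_stekDiff_le h hv x
    _ = ENNReal.ofReal v * eLpNorm (avg 0 v fun t => ‖G t‖ₑ) p (weightedMeasure γ) :=
        eLpNorm_const_mul_ennreal _ hp (measurable_avg h.right.measurable.enorm _ _)
    _ ≤ _ := by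
        gcongr
        exact eLpNorm_avg_enorm_le hK h.right hv hv'

/-- Each step spends one `highPass` to obtain a Steklov difference, and the difference to pass from
`F (r - i - 1)` to `F (r - i)` at the price `K / n`. -/
theorem eLpNorm_highPass_chain_le {p : ℝ≥0∞} (hp : 1 ≤ p) {γ : ℝ → ℝ≥0∞} {K : ℝ≥0∞}
    (hK : AvgBound p γ K) {n : ℕ} {B : ℝ} (hn : 1 ≤ n)
    (h₁ : SymbolBound (fun j : ℤ => cutoff (j / n)) n B)
    (h₂ : SymbolBound (fun j : ℤ => stekInvSymbol (j / n)) n B) {F : ℕ → ℝ → ℂ} {r : ℕ}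
    (hF : ∀ k < r, IsPrim (F k) (F (k + 1))) (b i : ℕ) (hi : i ≤ r) :
    eLpNorm ((highPass n)^[i + b] (F (r - i))) p (weightedMeasure γ) ≤
      (highPassConst B K * K) ^ i * ENNReal.ofReal (1 / n) ^ i *
        eLpNorm ((highPass n)^[b] (F r)) p (weightedMeasure γ) := by
  have hn0 : (0 : ℝ) < n := by exact_mod_cast hn
  have hv : (0 : ℝ) < 1 / n := by positivity
  have hv' : (1 : ℝ) / n ≤ 1 := by rw [div_le_one hn0]; exact_mod_cast hn
  induction i with
  | zero => simp
  | succ i ih =>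
    have hP := (hF (r - (i + 1)) (by omega)).highPass_iterate hn (i + b)
    rw [show r - (i + 1) + 1 = r - i by omega] at hP
    rw [show i + 1 + b = (i + b) + 1 by ring, Function.iterate_succ_apply']
    calc _ ≤ highPassConst B K * (ENNReal.ofReal (1 / n) *
          (K * eLpNorm ((highPass n)^[i + b] (F (r - i))) p (weightedMeasure γ))) := by
          refine (eLpNorm_highPass_le hp hK hn h₁ h₂ hP.left).trans ?_
          gcongr
          exact eLpNorm_stekDiff_le hp hK hP hv hv'
      _ ≤ highPassConst B K * (ENNReal.ofReal (1 / n) *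
          (K * ((highPassConst B K * K) ^ i * ENNReal.ofReal (1 / n) ^ i *
            eLpNorm ((highPass n)^[b] (F r)) p (weightedMeasure γ)))) := by
          gcongr
          exact ih (by omega)
      _ = _ := by ring

end

noncomputable section

/-! ### The de la Vallée-Poussin mean as a Fourier multiplier -/

/-- `n` times the symbol of the de la Vallée-Poussin mean. -/
def vpWeight (n : ℕ) (j : ℤ) : ℤ := max 0 (2 * n - |j|) - max 0 (n - |j|)

/-- The trapezoidal symbol of the de la Vallée-Poussin mean. -/
def vpSymbol (n : ℕ) (j : ℤ) : ℂ := (vpWeight n j : ℂ) / n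

theorem vpWeight_nonneg (n : ℕ) (j : ℤ) : 0 ≤ vpWeight n j := by
  rw [vpWeight]; grind

theorem vpWeight_le (n : ℕ) (j : ℤ) : vpWeight n j ≤ n := by
  rw [vpWeight]; grind

theorem vpSymbol_of_notMem {n : ℕ} {j : ℤ} (hj : j ∉ Finset.Icc (-(2 * n : ℤ)) (2 * n)) :
    vpSymbol n j = 0 := by
  have : vpWeight n j = 0 := by
    rw [vpWeight]
    rw [Finset.mem_Icc] at hj
    grind
  simp [vpSymbol, this]

theorem vpSymbol_of_abs_le {n : ℕ} (hn : 1 ≤ n) {j : ℤ} (hj : |j| ≤ n) : vpSymbol n j = 1 := by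
  have : vpWeight n j = n := by
    rw [vpWeight]; grind
  have hn' : (n : ℂ) ≠ 0 := by exact_mod_cast (by omega : n ≠ 0)
  rw [vpSymbol, this]
  push_cast
  field_simp

theorem summable_vpSymbol (n : ℕ) : Summable fun j => ‖vpSymbol n j‖ :=
  summable_of_ne_finset_zero (s := Finset.Icc (-(2 * n : ℤ)) (2 * n)) fun j hj => by
    rw [vpSymbol_of_notMem hj, norm_zero]

/-- A tent function is linear except at its two feet and its apex; the shift by `1` comes from the
forward difference. -/
theorem max_sub_abs_second_diff (N : ℕ) (j : ℤ) :
    max 0 (N - |j + 2|) - 2 * max 0 (N - |j + 1|) + max 0 (N - |j|) =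
      (if j = N - 1 then 1 else 0) + (if j = -N - 1 then 1 else 0) -
        2 * (if j = -1 then 1 else 0) := by
  rcases lt_trichotomy j (-1) with h | rfl | h
  · rw [abs_of_nonpos (by omega : j + 2 ≤ 0), abs_of_nonpos (by omega : j + 1 ≤ 0),
      abs_of_nonpos (by omega : j ≤ 0)]
    omega
  · norm_num
    omega
  · rw [abs_of_nonneg (by omega : 0 ≤ j + 2), abs_of_nonneg (by omega : 0 ≤ j + 1),
      abs_of_nonneg (by omega : 0 ≤ j)]
    omega

/-- The trapezoid is the difference of two tents of equal slopes, so the apex terms cancel and four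
unit masses remain at the corners. -/
theorem abs_vpWeight_diff_le (n : ℕ) (j : ℤ) :
    |vpWeight n (j + 2) - 2 * vpWeight n (j + 1) + vpWeight n j| ≤
      (if j = 2 * n - 1 then 1 else 0) + (if j = -(2 * n) - 1 then 1 else 0) +
        ((if j = n - 1 then 1 else 0) + (if j = -n - 1 then 1 else 0)) := by
  have h1 := max_sub_abs_second_diff (2 * n) j
  have h2 := max_sub_abs_second_diff n j
  push_cast at h1
  rw [show vpWeight n (j + 2) - 2 * vpWeight n (j + 1) + vpWeight n j =
    (max 0 (2 * n - |j + 2|) - 2 * max 0 (2 * n - |j + 1|) + max 0 (2 * n - |j|)) -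
      (max 0 (n - |j + 2|) - 2 * max 0 (n - |j + 1|) + max 0 (n - |j|)) by
    simp only [vpWeight]; ring, h1, h2, abs_le]
  have hI : ∀ P : Prop, ∀ _ : Decidable P, 0 ≤ (if P then (1 : ℤ) else 0) := fun P _ => by
    split_ifs <;> norm_num
  constructor
  · linarith [hI (j = 2 * n - 1) inferInstance, hI (j = -(2 * n) - 1) inferInstance]
  · linarith [hI (j = n - 1) inferInstance, hI (j = -n - 1) inferInstance]

/-- The constant `5` comes from the `4n + 1 ≤ 5n` frequencies; the corners need only `4`. -/
theorem symbolBound_vpSymbol {n : ℕ} (hn : 1 ≤ n) : SymbolBound (vpSymbol n) n 5 := by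
  have hn0 : (0 : ℝ) < n := by exact_mod_cast hn
  refine ⟨summable_vpSymbol n, ?_, ?_⟩
  · rw [tsum_eq_sum (s := Finset.Icc (-(2 * n : ℤ)) (2 * n)) fun j hj => by
      rw [vpSymbol_of_notMem hj, norm_zero]]
    have hle : ∀ j ∈ Finset.Icc (-(2 * n : ℤ)) (2 * n), ‖vpSymbol n j‖ ≤ 1 := by
      intro j _
      rw [vpSymbol, norm_div, Complex.norm_intCast, Complex.norm_natCast, div_le_one hn0,
        abs_of_nonneg (by exact_mod_cast vpWeight_nonneg n j)]
      exact_mod_cast vpWeight_le n j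
    refine (Finset.sum_le_card_nsmul _ _ _ hle).trans ?_
    rw [Int.card_Icc, nsmul_eq_mul, mul_one]
    have : ((2 * n + 1 - -(2 * n) : ℤ).toNat) = 4 * n + 1 := by omega
    rw [this]
    push_cast
    have : (1 : ℝ) ≤ n := by exact_mod_cast hn
    linarith
  · have hs : HasSum (fun j : ℤ => (1 / n : ℝ) *
        (((if j = 2 * n - 1 then 1 else 0) + (if j = -(2 * n) - 1 then 1 else 0)) +
          ((if j = n - 1 then 1 else 0) + (if j = -n - 1 then 1 else 0)))) (1 / n * (1 + 1 + (1 + 1))) :=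
      (((hasSum_ite_eq _ _).add (hasSum_ite_eq _ _)).add
        ((hasSum_ite_eq _ _).add (hasSum_ite_eq _ _))).mul_left _
    have hle : ∀ j, ‖vpSymbol n (j + 2) - 2 * vpSymbol n (j + 1) + vpSymbol n j‖ ≤ (1 / n : ℝ) *
        (((if j = 2 * n - 1 then 1 else 0) + (if j = -(2 * n) - 1 then 1 else 0)) +
          ((if j = n - 1 then 1 else 0) + (if j = -n - 1 then 1 else 0))) := by
      intro j
      have e : vpSymbol n (j + 2) - 2 * vpSymbol n (j + 1) + vpSymbol n j =
          ((vpWeight n (j + 2) - 2 * vpWeight n (j + 1) + vpWeight n j : ℤ) : ℂ) / n := by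
        simp only [vpSymbol]; push_cast; ring
      rw [e, norm_div, Complex.norm_intCast, Complex.norm_natCast, div_eq_inv_mul, one_div]
      gcongr
      exact_mod_cast abs_vpWeight_diff_le n j
    refine ((Summable.of_nonneg_of_le (fun _ => norm_nonneg _) hle hs.summable).tsum_le_tsum hle
      hs.summable).trans ?_
    rw [hs.tsum_eq, one_div_mul_eq_div]
    gcongr
    norm_num

/-- The cut-off lives on `|j| < n`, where the trapezoid equals `1`. -/
theorem mult_vpSymbol_mult_cutoff {n : ℕ} (hn : 1 ≤ n) (f : ℝ → ℂ) :
    mult (vpSymbol n) (mult (fun j => cutoff (j / n)) f) = mult (fun j => cutoff (j / n)) f := by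
  have hq := summable_cutoff hn
  refine eq_of_coef_eq (continuous_mult (summable_vpSymbol n) _) (continuous_mult hq _)
    (PerInt.mult (summable_vpSymbol n) _).periodic (PerInt.mult hq _).periodic ?_ fun j => ?_
  · simp only [coef_mult hq]
    exact summable_mult_term hq _
  · rw [coef_mult (summable_vpSymbol n), coef_mult hq]
    by_cases h : cutoff (j / n) = 0
    · rw [h]; ring
    · rw [vpSymbol_of_abs_le hn (abs_lt_of_cutoff_ne_zero hn h).le, one_mul]

/-- The complexification of a real function. -/
def toC (f : ℝ → ℝ) (x : ℝ) : ℂ := f x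

/-! ### Real Fourier sums in terms of complex coefficients. -/

theorem PerInt.intervalIntegrable_re_mul {f : ℝ → ℝ} (hf : PerInt (toC f)) {g : ℝ → ℝ}
    (hg : Continuous g) (a b : ℝ) : IntervalIntegrable (fun t => f t * g t) volume a b := by
  have : IntervalIntegrable f volume a b := by
    have := hf.integrable a b
    exact ⟨this.1.re, this.2.re⟩
  exact this.mul_continuousOn hg.continuousOn

theorem echar_eq (j : ℤ) (x : ℝ) :
    echar j x = (Real.cos (j * x) : ℂ) + Complex.I * (Real.sin (j * x) : ℂ) := by
  rw [echar, mul_comm Complex.I, Complex.exp_mul_I, Complex.ofReal_cos, Complex.ofReal_sin,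
    mul_comm _ Complex.I]

theorem coef_toC {f : ℝ → ℝ} (hf : PerInt (toC f)) (k : ℕ) :
    coef (toC f) k = (fourierCos f k - Complex.I * fourierSin f k) / 2 ∧
      coef (toC f) (-k) = (fourierCos f k + Complex.I * fourierSin f k) / 2 := by
  have hc := hf.intervalIntegrable_re_mul (g := fun t => Real.cos (k * t)) (by fun_prop)
    (-Real.pi) Real.pi
  have hs := hf.intervalIntegrable_re_mul (g := fun t => Real.sin (k * t)) (by fun_prop)
    (-Real.pi) Real.pi
  have hc' : IntervalIntegrable (fun t => ((f t * Real.cos (k * t) : ℝ) : ℂ)) volume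
    (-Real.pi) Real.pi := ⟨hc.1.ofReal, hc.2.ofReal⟩
  have hs' : IntervalIntegrable (fun t => ((f t * Real.sin (k * t) : ℝ) : ℂ)) volume
    (-Real.pi) Real.pi := ⟨hs.1.ofReal, hs.2.ofReal⟩
  have hpi : (Real.pi : ℂ) ≠ 0 := by exact_mod_cast Real.pi_ne_zero
  have e1 : ∀ t : ℝ, echar (-(k : ℤ)) t * toC f t = ((f t * Real.cos (k * t) : ℝ) : ℂ) -
      Complex.I * ((f t * Real.sin (k * t) : ℝ) : ℂ) := by
    intro t
    rw [echar_neg, echar_eq, toC]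
    simp only [Int.cast_natCast, mul_neg, Real.cos_neg, Real.sin_neg]
    push_cast; ring
  have e2 : ∀ t : ℝ, echar (-(-(k : ℤ))) t * toC f t = ((f t * Real.cos (k * t) : ℝ) : ℂ) +
      Complex.I * ((f t * Real.sin (k * t) : ℝ) : ℂ) := by
    intro t
    rw [neg_neg, echar_eq, toC]
    simp only [Int.cast_natCast]
    push_cast; ring
  rw [coef, coef]
  simp only [e1, e2]
  rw [intervalIntegral.integral_sub hc' (hs'.const_mul _),
    intervalIntegral.integral_add hc' (hs'.const_mul _), intervalIntegral.integral_const_mul,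
    intervalIntegral.integral_ofReal, intervalIntegral.integral_ofReal, fourierCos, fourierSin]
  push_cast
  constructor <;> field_simp

theorem trigSum_fourier {f : ℝ → ℝ} (hf : PerInt (toC f)) (m : ℕ) (x : ℝ) :
    (partialSum m f x : ℂ) =
      ∑ j ∈ Finset.Icc (-(m : ℤ)) m, coef (toC f) j * echar j x := by
  induction m with
  | zero =>
    have := (coef_toC hf 0).1
    have h2 : fourierSin f 0 = 0 := by simp [fourierSin]
    rw [h2] at this
    simp only [Nat.cast_zero] at this
    simp [partialSum, trigSum, this]
  | succ m ih =>
    have hS : Finset.Icc (-((m + 1 : ℕ) : ℤ)) ((m + 1 : ℕ) : ℤ) =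
        insert ((m + 1 : ℕ) : ℤ) (insert (-((m + 1 : ℕ) : ℤ)) (Finset.Icc (-(m : ℤ)) m)) := by
      ext j
      simp only [Finset.mem_Icc, Finset.mem_insert]
      omega
    have n1 : (-((m + 1 : ℕ) : ℤ)) ∉ Finset.Icc (-(m : ℤ)) m := by
      rw [Finset.mem_Icc]; omega
    have n2 : ((m + 1 : ℕ) : ℤ) ∉ insert (-((m + 1 : ℕ) : ℤ)) (Finset.Icc (-(m : ℤ)) m) := by
      rw [Finset.mem_insert, Finset.mem_Icc]; omega
    rw [hS, Finset.sum_insert n2, Finset.sum_insert n1, ← ih, (coef_toC hf (m + 1)).1,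
      (coef_toC hf (m + 1)).2, partialSum, trigSum, Finset.sum_Icc_succ_top (by omega), partialSum,
      trigSum, echar_neg, echar_eq, echar_eq]
    simp only [Int.cast_natCast, mul_neg, Real.cos_neg, Real.sin_neg]
    push_cast
    linear_combination (fourierSin f (m + 1) * Complex.sin ((m + 1) * x) : ℂ) * Complex.I_sq

theorem sum_ite_eq_vpWeight (n : ℕ) (j : ℤ) :
    ∑ i ∈ Finset.range n, (if |j| ≤ (n + i : ℕ) then (1 : ℤ) else 0) = vpWeight n j := by
  have h : ∀ k : ℕ, ∑ i ∈ Finset.range k, (if |j| ≤ (n + i : ℕ) then (1 : ℤ) else 0) =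
      max 0 (n + k - |j|) - max 0 (n - |j|) := by
    intro k
    induction k with
    | zero => simp
    | succ k ih =>
      rw [Finset.sum_range_succ, ih]
      push_cast
      split_ifs <;> grind
  rw [h n, vpWeight]
  congr 2
  ring

theorem valleePoussin_eq_mult {f : ℝ → ℝ} (hf : PerInt (toC f)) (n : ℕ) (x : ℝ) :
    (valleePoussin n f x : ℂ) = mult (vpSymbol n) (toC f) x := by
  rw [mult, tsum_eq_sum (s := Finset.Icc (-(2 * n : ℤ)) (2 * n)) fun j hj => by
      rw [vpSymbol_of_notMem hj]; ring, valleePoussin]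
  push_cast
  have h : ∀ i ∈ Finset.range n, (partialSum (n + i) f x : ℂ) =
      ∑ j ∈ Finset.Icc (-(2 * n : ℤ)) (2 * n),
        ((if |j| ≤ (n + i : ℕ) then (1 : ℤ) else 0 : ℤ) : ℂ) * (coef (toC f) j * echar j x) := by
    intro i hi
    rw [Finset.mem_range] at hi
    rw [trigSum_fourier hf]
    refine Finset.sum_subset_zero_on_sdiff (Finset.Icc_subset_Icc (by push_cast; omega)
      (by push_cast; omega)) (fun j hj => ?_) fun j hj => ?_
    · rw [Finset.mem_sdiff, Finset.mem_Icc, Finset.mem_Icc] at hj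
      rw [if_neg (by rw [abs_le]; exact hj.2)]
      simp
    · rw [Finset.mem_Icc] at hj
      rw [if_pos (abs_le.2 hj)]
      simp
  rw [Finset.sum_congr rfl h, Finset.sum_comm, Finset.mul_sum]
  refine Finset.sum_congr rfl fun j _ => ?_
  rw [← Finset.sum_mul, ← Int.cast_sum, sum_ite_eq_vpWeight, vpSymbol]
  ring

theorem valleePoussin_mem_trigPoly {n : ℕ} (hn : 1 ≤ n) (f : ℝ → ℝ) :
    valleePoussin n f ∈ trigPoly (2 * n - 1) := by
  have hn0 : (n : ℝ) ≠ 0 := by exact_mod_cast (by omega : n ≠ 0)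
  -- `w k` is the proportion of the sums `S_n, …, S_{2n-1}` in which the frequency `k` occurs.
  set w : ℕ → ℝ := fun k => (1 / n) * ∑ i ∈ Finset.range n, if k ≤ n + i then 1 else 0 with hw
  refine ⟨fun k => w k * fourierCos f k, fun k => w k * fourierSin f k, ?_⟩
  ext x
  have hw0 : w 0 = 1 := by
    simp only [hw, zero_le, if_true, Finset.sum_const, Finset.card_range, nsmul_eq_mul, mul_one]
    field_simp
  have h : ∀ i ∈ Finset.range n, partialSum (n + i) f x = fourierCos f 0 / 2 +
      ∑ k ∈ Finset.Icc 1 (2 * n - 1), (if k ≤ n + i then 1 else 0) *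
        (fourierCos f k * Real.cos (k * x) + fourierSin f k * Real.sin (k * x)) := by
    intro i hi
    rw [Finset.mem_range] at hi
    rw [partialSum, trigSum]
    congr 1
    refine Finset.sum_subset_zero_on_sdiff (Finset.Icc_subset_Icc le_rfl (by omega))
      (fun k hk => ?_) fun k hk => ?_
    · rw [Finset.mem_sdiff, Finset.mem_Icc, Finset.mem_Icc] at hk
      rw [if_neg (by omega), zero_mul]
    · rw [Finset.mem_Icc] at hk
      rw [if_pos hk.2, one_mul]
  simp only [valleePoussin, trigSum]
  have e1 : (1 / n : ℝ) * ∑ _i ∈ Finset.range n, fourierCos f 0 / 2 = w 0 * fourierCos f 0 / 2 := by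
    rw [hw0, Finset.sum_const, Finset.card_range, nsmul_eq_mul]
    field_simp
  rw [Finset.sum_congr rfl h, Finset.sum_add_distrib, mul_add, e1, Finset.sum_comm, Finset.mul_sum]
  refine congrArg (w 0 * fourierCos f 0 / 2 + ·) (Finset.sum_congr rfl fun k _ => ?_)
  rw [← Finset.sum_mul]
  simp only [hw]
  ring

end

/-! ### Simultaneous approximation -/

theorem periodic_iteratedDeriv {f : ℝ → ℝ} {c : ℝ} (hf : Function.Periodic f c) (k : ℕ) :
    Function.Periodic (iteratedDeriv k f) c := by
  induction k with
  | zero => simpa using hf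
  | succ k ih =>
    intro x
    rw [iteratedDeriv_succ, ← deriv_comp_add_const]
    congr 1
    exact funext ih

theorem MemW.continuous {r : ℕ} {p : ℝ≥0∞} {γ : ℝ → ℝ≥0∞} {f : ℝ → ℝ} (h : MemW r p γ f) {k : ℕ}
    (hk : k < r) : Continuous (iteratedDeriv k f) :=
  h.contDiff.continuous_iteratedDeriv k (by exact_mod_cast (by omega : k ≤ r - 1))

/-- Below order `r` the derivatives are continuous; at order `r` integrability comes from the
absolute continuity of the derivative of order `r - 1`, not from the weighted norm. -/
theorem MemW.perInt {r : ℕ} (hr : 1 ≤ r) {p : ℝ≥0∞} {γ : ℝ → ℝ≥0∞} {f : ℝ → ℝ} (h : MemW r p γ f)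
    {k : ℕ} (hk : k ≤ r) : PerInt (toC (iteratedDeriv k f)) := by
  have hp : Function.Periodic (toC (iteratedDeriv k f)) (2 * Real.pi) := fun x => by
    rw [toC, periodic_iteratedDeriv h.mem.1 k x, toC]
  rcases hk.lt_or_eq with hk | rfl
  · exact PerInt.of_continuous (Complex.continuous_ofReal.comp (h.continuous hk)) hp
  · obtain ⟨k, rfl⟩ : ∃ m, k = m + 1 := ⟨k - 1, by omega⟩
    refine ⟨Complex.measurable_ofReal.comp ?_, hp, fun a b => ?_⟩
    · rw [iteratedDeriv_succ]; exact measurable_deriv _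
    · have := (h.absCont a b).intervalIntegrable_deriv
      rw [Nat.add_sub_cancel, ← iteratedDeriv_succ] at this
      exact ⟨this.1.ofReal, this.2.ofReal⟩

theorem MemW.isPrim {r : ℕ} (hr : 1 ≤ r) {p : ℝ≥0∞} {γ : ℝ → ℝ≥0∞} {f : ℝ → ℝ} (h : MemW r p γ f)
    {k : ℕ} (hk : k < r) :
    IsPrim (toC (iteratedDeriv k f)) (toC (iteratedDeriv (k + 1) f)) := by
  refine ⟨h.perInt hr hk.le, h.perInt hr hk, fun a b => ?_⟩
  have key : ∫ t in a..b, iteratedDeriv (k + 1) f t = iteratedDeriv k f b - iteratedDeriv k f a := by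
    rw [iteratedDeriv_succ]
    rcases (show k + 1 ≤ r from hk).lt_or_eq with hk' | rfl
    · have hd : Differentiable ℝ (iteratedDeriv k f) :=
        h.contDiff.differentiable_iteratedDeriv k (by exact_mod_cast (by omega : k < r - 1))
      refine intervalIntegral.integral_eq_sub_of_hasDerivAt (fun x _ => (hd x).hasDerivAt) ?_
      rw [← iteratedDeriv_succ]
      exact (h.continuous hk').intervalIntegrable _ _
    · exact (h.absCont a b).integral_deriv_eq_sub
  simp only [toC]
  rw [intervalIntegral.integral_ofReal, key]
  push_cast; rfl

/-- `V_n` is a multiplier of finite support, so it can be differentiated term by term, and the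
coefficients of the derivative are those of `f` times `i j`. -/
theorem iteratedDeriv_valleePoussin {r : ℕ} (hr : 1 ≤ r) {p : ℝ≥0∞} {γ : ℝ → ℝ≥0∞} {f : ℝ → ℝ}
    (h : MemW r p γ f) (n k : ℕ) (hk : k ≤ r) :
    iteratedDeriv k (valleePoussin n f) = valleePoussin n (iteratedDeriv k f) := by
  induction k with
  | zero => simp
  | succ k ih =>
    have hP := h.isPrim hr (k := k) (by omega)
    rw [iteratedDeriv_succ, ih (by omega)]
    ext x
    have hd := hasDerivAt_mult (fun j hj => vpSymbol_of_notMem (n := n) hj) hP x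
    have hre := Complex.reCLM.hasFDerivAt.comp_hasDerivAt x hd
    have e : ∀ y, (mult (vpSymbol n) (toC (iteratedDeriv k f)) y).re =
        valleePoussin n (iteratedDeriv k f) y := fun y => by
      rw [← valleePoussin_eq_mult hP.left, Complex.ofReal_re]
    have e' : (mult (vpSymbol n) (toC (iteratedDeriv (k + 1) f)) x).re =
        valleePoussin n (iteratedDeriv (k + 1) f) x := by
      rw [← valleePoussin_eq_mult hP.right, Complex.ofReal_re]
    have hfun : (Complex.reCLM ∘ mult (vpSymbol n) (toC (iteratedDeriv k f))) =
        valleePoussin n (iteratedDeriv k f) := funext e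
    rw [hfun] at hre
    exact hre.deriv.trans e'

theorem eLpNorm_toC (f : ℝ → ℝ) (p : ℝ≥0∞) (μ : Measure ℝ) :
    eLpNorm (toC f) p μ = eLpNorm f p μ :=
  eLpNorm_congr_norm_ae (Filter.Eventually.of_forall fun x => by simp [toC])

theorem toC_sub_steklov {v : ℝ} (hv : v ≠ 0) (f : ℝ → ℝ) :
    toC (f - steklov v f) = stekDiff v (toC f) := by
  ext x
  simp only [toC, stekDiff, Pi.sub_apply, cstek, steklov, if_neg hv]
  rw [intervalIntegral.integral_ofReal]
  push_cast; rfl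

theorem modulus_eq (l : ℕ) (p : ℝ≥0∞) (γ : ℝ → ℝ≥0∞) (f : ℝ → ℝ) {v : ℝ} (hv : v ≠ 0) :
    modulus l p γ f v = eLpNorm ((stekDiff v)^[l] (toC f)) p (weightedMeasure γ) := by
  rw [modulus, wnorm, ← eLpNorm_toC]
  congr 1
  induction l generalizing f with
  | zero => rfl
  | succ l ih =>
    rw [Function.iterate_succ_apply, Function.iterate_succ_apply, ih, toC_sub_steklov hv]

/-- `I - V_n` annihilates the low-frequency part that `highPass` subtracts, so any number of factors
`highPass` can be inserted. -/
theorem sub_mult_vpSymbol_eq {n : ℕ} (hn : 1 ≤ n) {f : ℝ → ℂ} (hf : PerInt f) (m : ℕ) :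
    f - mult (vpSymbol n) f =
      (highPass n)^[m] f - mult (vpSymbol n) ((highPass n)^[m] f) := by
  induction m with
  | zero => rfl
  | succ m ih =>
    have hm := hf.highPass_iterate hn m
    rw [ih, Function.iterate_succ_apply', highPass,
      mult_sub (summable_vpSymbol n) hm (PerInt.mult (summable_cutoff hn) _),
      mult_vpSymbol_mult_cutoff hn]
    abel

theorem eLpNorm_sub_valleePoussin_le {p : ℝ≥0∞} (hp : 1 ≤ p) {γ : ℝ → ℝ≥0∞} {K : ℝ≥0∞}
    (hK : AvgBound p γ K) {n : ℕ} {B : ℝ} (hn : 1 ≤ n) (hB : 5 ≤ B)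
    (h₁ : SymbolBound (fun j : ℤ => cutoff (j / n)) n B)
    (h₂ : SymbolBound (fun j : ℤ => stekInvSymbol (j / n)) n B) {r : ℕ} (hr : 1 ≤ r) (l : ℕ)
    {f : ℝ → ℝ} (hf : MemW r p γ f) {k : ℕ} (hk : k ≤ r) :
    wnorm p γ (iteratedDeriv k f - valleePoussin n (iteratedDeriv k f)) ≤
      (1 + ENNReal.ofReal (48 * B) * K) * (1 + highPassConst B K * K) ^ r *
        highPassConst B K ^ l * ENNReal.ofReal (1 / n) ^ (r - k) *
        modulus l p γ (iteratedDeriv r f) (1 / n) := by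
  have hn0 : (0 : ℝ) < n := by exact_mod_cast hn
  have hF := hf.perInt hr hk
  have hFr := hf.perInt hr le_rfl
  have e : toC (iteratedDeriv k f - valleePoussin n (iteratedDeriv k f)) =
      toC (iteratedDeriv k f) - mult (vpSymbol n) (toC (iteratedDeriv k f)) := by
    ext x
    rw [Pi.sub_apply, ← valleePoussin_eq_mult hF]
    simp [toC]
  have chain := eLpNorm_highPass_chain_le hp hK hn h₁ h₂
    (F := fun k => toC (iteratedDeriv k f)) (fun k hk => hf.isPrim hr hk) l (r - k) (by omega)
  rw [show r - (r - k) = k by omega] at chain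
  rw [wnorm, ← eLpNorm_toC, e, sub_mult_vpSymbol_eq hn hF (r - k + l),
    modulus_eq _ _ _ _ (by positivity)]
  set X := (highPass n)^[r - k + l] (toC (iteratedDeriv k f))
  set M := eLpNorm ((stekDiff (1 / n))^[l] (toC (iteratedDeriv r f))) p (weightedMeasure γ)
  -- This makes the constant independent of `k`.
  have hpow : (highPassConst B K * K) ^ (r - k) ≤ (1 + highPassConst B K * K) ^ r :=
    (pow_le_pow_left₀ zero_le le_add_self _).trans
      (pow_le_pow_right₀ le_self_add (Nat.sub_le r k))
  calc _ ≤ (1 + ENNReal.ofReal (48 * B) * K) * eLpNorm X p (weightedMeasure γ) :=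
        eLpNorm_sub_mult_le hp hK hn ((symbolBound_vpSymbol hn).mono hB)
          (hF.highPass_iterate hn _)
    _ ≤ (1 + ENNReal.ofReal (48 * B) * K) * ((highPassConst B K * K) ^ (r - k) *
          ENNReal.ofReal (1 / n) ^ (r - k) * (highPassConst B K ^ l * M)) := by
        gcongr
        refine chain.trans ?_
        gcongr
        exact eLpNorm_highPass_iterate_le hp hK hn h₁ h₂ l hFr
    _ ≤ (1 + ENNReal.ofReal (48 * B) * K) * ((1 + highPassConst B K * K) ^ r *
          ENNReal.ofReal (1 / n) ^ (r - k) * (highPassConst B K ^ l * M)) := by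
        exact mul_le_mul_right (mul_le_mul_left (mul_le_mul_left hpow _) _) _
    _ = _ := by ring

end TrigApprox

/-- Here `A` bounds `[γ]_p`, and `c` matters for `p = 1` only, where it is a lower bound of `γ`:
the constant `C` depends on `p, l, r` and `A`, and for `p = 1` also on `c`. -/
theorem theoremS3 (p : ℝ≥0∞) (hp : 1 ≤ p) (r l : ℕ) (hr : 1 ≤ r) (hl : 1 ≤ l)
    (A : ℝ≥0) (c : ℝ≥0) (hc : 0 < c) :
    ∃ C : ℝ, 0 < C ∧
      ∀ γ : ℝ → ℝ≥0∞, TrigApprox.IsASWeight p γ → TrigApprox.weightConst p γ ≤ A →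
        (p = 1 → ∀ᵐ x, (c : ℝ≥0∞) ≤ γ x) →
      ∀ n : ℕ, 1 ≤ n → ∀ f : ℝ → ℝ, TrigApprox.MemW r p γ f →
        ∃ Φ ∈ TrigApprox.trigPoly (2 * n - 1), Φ = TrigApprox.valleePoussin n f ∧
          ∀ k : ℕ, k ≤ r →
            TrigApprox.wnorm p γ (iteratedDeriv k f - iteratedDeriv k Φ) ≤
              ENNReal.ofReal (C / (n : ℝ) ^ (r - k)) *
                TrigApprox.modulus l p γ (iteratedDeriv r f) (1 / (n : ℝ)) := by
  obtain ⟨K, hK⟩ := TrigApprox.exists_avgBound hp A hc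
  obtain ⟨B, hB⟩ := TrigApprox.exists_symbolBound_highPass
  -- One constant for the three symbols: the cut-off, the inverse of `I - T`, and the trapezoid,
  -- which needs `5`.
  set B' := max B 5 with hB'
  set E : ℝ≥0∞ := (1 + ENNReal.ofReal (48 * B') * K) *
    (1 + TrigApprox.highPassConst B' K * K) ^ r * TrigApprox.highPassConst B' K ^ l with hE
  have hc1 : ENNReal.ofReal (48 * B') * K ≠ ∞ :=
    ENNReal.mul_ne_top ENNReal.ofReal_ne_top ENNReal.coe_ne_top
  have hc2 : TrigApprox.highPassConst B' K ≠ ∞ := by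
    rw [TrigApprox.highPassConst]
    exact ENNReal.add_ne_top.2 ⟨ENNReal.mul_ne_top (ENNReal.add_ne_top.2 ⟨ENNReal.one_ne_top, hc1⟩)
      (ENNReal.add_ne_top.2 ⟨ENNReal.one_ne_top, ENNReal.coe_ne_top⟩), hc1⟩
  have hEt : E ≠ ∞ :=
    ENNReal.mul_ne_top (ENNReal.mul_ne_top (ENNReal.add_ne_top.2 ⟨ENNReal.one_ne_top, hc1⟩)
      (ENNReal.pow_ne_top (ENNReal.add_ne_top.2 ⟨ENNReal.one_ne_top,
        ENNReal.mul_ne_top hc2 ENNReal.coe_ne_top⟩))) (ENNReal.pow_ne_top hc2)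
  -- The summand `1` ensures `C > 0`.
  refine ⟨E.toReal + 1, by positivity, fun γ hγ hA hcγ n hn f hf =>
    ⟨TrigApprox.valleePoussin n f, TrigApprox.valleePoussin_mem_trigPoly hn f, rfl,
      fun k hk => ?_⟩⟩
  have hn0 : (0 : ℝ) < n := by exact_mod_cast hn
  rw [TrigApprox.iteratedDeriv_valleePoussin hr hf n k hk]
  refine (TrigApprox.eLpNorm_sub_valleePoussin_le hp (hK γ hγ hA hcγ) hn (le_max_right B 5)
    ((hB n hn).1.mono (le_max_left _ _)) ((hB n hn).2.mono (le_max_left _ _)) hr l hf hk).trans ?_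
  have e : (E.toReal + 1) / (n : ℝ) ^ (r - k) = (E.toReal + 1) * (1 / n) ^ (r - k) := by
    rw [one_div_pow]; ring
  rw [← hB', ← hE, e, ENNReal.ofReal_mul (by positivity), ENNReal.ofReal_pow (by positivity)]
  gcongr
  exact (ENNReal.le_ofReal_iff_toReal_le hEt (by positivity)).2 (by linarith)
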